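/- Let $G=(V,E,c)$ be a finite undirected graph with positive edge costs $c$; $c(A,B)$ denotes the total cost of the edges between disjoint sets $A,B\subseteq V$. A set $S\subseteq V$ is a source community (SC) if there is a source $s\in S$ such that $c(U,S\setminus U)>c(U,V\setminus S)$ for every nonempty $U\subseteq S$ with $s\notin U$. A clustering is a partition of $V$; a clustering $\Omega$ is nested in $\Omega'$, written $\Omega\le\Omega'$, if every cluster of $\Omega$ is a subset of a cluster of $\Omega'$. For an SC $S$, the maximal SC clustering $\Omega(S)$ is the clustering that contains $S$, consists of SCs, and in which every other clustering that contains $S$ and consists of SCs is nested. An overlay clustering for disjoint SCs $S_1,\dots,S_k$ is a maximal clustering (with respect to $\le$) among all clusterings that are nested in each of $\Omega(S_1),\dots,\Omega(S_k)$. For $s\ne t$ in $V$ let $SC(s,t)$ be the side containing $s$ of the minimum $s$-$t$-cut that has the fewest vertices on the side of $s$. Let $T(G)$ be a rooted tree on $V$, with edges directed away from the root, such that for every edge $(t,s)$ the vertex set of the subtree below $s$ is $SC(s,t)$, and $|SC(s,t)|\le|SC(t,s)|$. The preprocessed data $M(G)\supset T(G)$ consist of such a tree $T(G)$, given by the parent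 of each vertex, and of a $0$-$1$ membership table of the opposite SCs $SC(t,s)$ of all edges $(t,s)$ of $T(G)$. **Theorem.** Let $S_1,\dots,S_k$ be pairwise disjoint SCs in $G$. 1. Each $\Omega(S_i)$ exists and is unique, and there is a unique overlay clustering $\Omega(S_1,\dots,S_k)$ for $S_1,\dots,S_k$. It contains $S_1,\dots,S_k$, it is nested in each $\Omega(S_i)$, and every clustering that consists of SCs and contains $S_1,\dots,S_k$ is nested in it. 2. The overlay clustering can be computed in $O(kn)$ time after preprocessing: there are a single program for a unit-cost random access machine (with comparison, successor and predecessor as its only arithmetic, and with memory organized in two-dimensional arrays) and a constant $C$ such that for all $n$, all $k\ge 1$, every graph $G$ on $\{0,\dots,n-1\}$, all preprocessed data $M(G)\supset T(G)$ and all disjoint SCs $S_1,\dots,S_k$ of $G$, given by their membership tables, the program halts after at most $Ckn$ steps with a coloring of the vertices in memory whose color classes are exactly the clusters of $\Omega(S_1,\dots,S_k)$. -/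

import Mathlib

/-! ## Weighted graphs, source communities and clusterings -/

/-- An undirected graph with a positive cost on every edge. -/
structure WeightedGraph (V : Type*) extends SimpleGraph V where
  /-- the edge costs; only the values on edges matter -/
  cost : Sym2 V → ℝ
  cost_pos : ∀ e ∈ toSimpleGraph.edgeSet, 0 < cost e

namespace WeightedGraph

section

variable {V : Type*} (G : WeightedGraph V)

open Classical in
/-- The cost of the pair `u, v`: its edge cost, or `0` if it is not an edge. -/
noncomputable def weight (u v : V) : ℝ :=
  if G.Adj u v then G.cost s(u, v) else 0

/-- `c(A, B)` for disjoint `A`, `B`: the total cost of the edges between `A` and `B`. -/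
noncomputable def cutCost (A B : Finset V) : ℝ :=
  ∑ a ∈ A, ∑ b ∈ B, G.weight a b

variable [Fintype V] [DecidableEq V]

/-- `S` is a source community with source `s ∈ S`: every nonempty `U ⊆ S` that avoids `s` is
connected more strongly to the rest of `S` than to the outside of `S`. -/
def IsSCOf (s : V) (S : Finset V) : Prop :=
  s ∈ S ∧ ∀ U : Finset V, U ⊆ S → s ∉ U → U.Nonempty →
    G.cutCost U Sᶜ < G.cutCost U (S \ U)

/-- `S` is a source community (SC). -/
def IsSC (S : Finset V) : Prop := ∃ s, G.IsSCOf s S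

/-- `S` is the side of `s` in an `s`-`T`-cut. -/
def Separates (s : V) (T S : Finset V) : Prop := s ∈ S ∧ Disjoint S T

/-- `S` is the side of `s` in a minimum `s`-`T`-cut. -/
def IsMinCutSide (s : V) (T S : Finset V) : Prop :=
  Separates s T S ∧ ∀ S', Separates s T S' → G.cutCost S Sᶜ ≤ G.cutCost S' S'ᶜ

/-- `S = SC(s, T)`: among the minimum `s`-`T`-cuts, the one with side `S` has the smallest number
of vertices on the side of `s`. -/
def IsSCWrt (s : V) (T S : Finset V) : Prop :=
  G.IsMinCutSide s T S ∧ ∀ S', G.IsMinCutSide s T S' → S.card ≤ S'.card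

/-- A clustering is a partition of the vertex set; `Ω ≤ Ω'` says that `Ω` is hierarchically
nested in `Ω'`: every cluster of `Ω` is a subset of a cluster of `Ω'`. -/
abbrev Clustering (V : Type*) [Fintype V] [DecidableEq V] : Type _ :=
  Finpartition (Finset.univ : Finset V)

/-- All clusters of `Ω` are SCs. -/
def IsSCClustering (Ω : Clustering V) : Prop := ∀ C ∈ Ω.parts, G.IsSC C

/-- `Ω = Ω(S)`, the maximal SC clustering for `S`: the maximum of the clusterings that consist of
`S` and further SCs. -/
def IsMaxSCClustering (S : Finset V) (Ω : Clustering V) : Prop :=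
  IsGreatest {Ω' : Clustering V | S ∈ Ω'.parts ∧ G.IsSCClustering Ω'} Ω

/-- `Ω` is nested in the maximal SC clustering of each `S i`. -/
def NestedInAll {k : ℕ} (S : Fin k → Finset V) (Ω : Clustering V) : Prop :=
  ∀ i, ∀ Ωi : Clustering V, G.IsMaxSCClustering (S i) Ωi → Ω ≤ Ωi

/-- `Ω` is an overlay clustering for `S 0, …, S (k - 1)`: maximal among all clusterings that are
nested in each of the maximal SC clusterings of the `S i`. -/
def IsOverlayClustering {k : ℕ} (S : Fin k → Finset V) (Ω : Clustering V) : Prop :=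
  Maximal (G.NestedInAll S) Ω

end

end WeightedGraph

/-! ## The preprocessed data: the special cut tree and the opposite SCs -/

/-- A rooted tree on the vertex set `V`, given by the parents (the root is its own parent). -/
structure ParentTree (V : Type*) where
  root : V
  parent : V → V
  parent_root : parent root = root
  reaches_root : ∀ v, ∃ i : ℕ, parent^[i] v = root

namespace ParentTree

open Classical in
/-- The vertices of the subtree below `v`. Deleting the edge from `parent v` to `v` splits the
tree into this set and its complement. -/
noncomputable def subtree {V : Type*} [Fintype V] (T : ParentTree V) (v : V) : Finset V :=
  Finset.univ.filter fun u => ∃ i : ℕ, T.parent^[i] u = v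

end ParentTree

/-- The result of the preprocessing: a rooted cut tree whose edges `(t, s)`, directed from
`t = parent s` to `s`, represent `SC(s, t)` with `|SC(s, t)| ≤ |SC(t, s)|`, together with the
opposite SC `SC(t, s)` of every edge. (The set attached to the root, which has no edge to a
parent, is arbitrary.) -/
structure Preprocessed {V : Type*} [Fintype V] [DecidableEq V] (G : WeightedGraph V) extends
    ParentTree V where
  /-- `opposite s` is the opposite SC of the edge from `parent s` to `s` -/
  opposite : V → Finset V
  subtree_isSC : ∀ s, s ≠ root → G.IsSCWrt s {parent s} (toParentTree.subtree s)
  opposite_isSC : ∀ s, s ≠ root → G.IsSCWrt (parent s) {s} (opposite s)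
  card_le : ∀ s, s ≠ root → (toParentTree.subtree s).card ≤ (opposite s).card

/-! ## Random access machine with unit costs

The memory consists of registers and two-dimensional arrays, all of which hold natural numbers.
A program names finitely many of them. The only arithmetic is successor and predecessor, so that a
run of `t` steps increases the largest stored number by at most `t`, up to the constants in the
program: no unit-cost operation ever works on more than logarithmically many bits. -/

/-- The contents of the memory. -/
structure RamState where
  /-- the registers -/
  reg : ℕ → ℕ
  /-- `arr a i j` is the entry in row `i` and column `j` of the array `a` -/
  arr : ℕ → ℕ → ℕ → ℕ

/-- The tests: comparisons of two registers. -/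
inductive RamTest
  | eq (x y : ℕ)
  | lt (x y : ℕ)

/-- When a test succeeds. -/
def RamTest.Holds : RamTest → RamState → Prop
  | .eq x y, σ => σ.reg x = σ.reg y
  | .lt x y, σ => σ.reg x < σ.reg y

/-- Programs. The arguments `x y i j` are numbers of registers, `a` is the number of an array and
`m` is a constant. -/
inductive RamProgram
  | skip
  /-- `x := m` -/
  | const (x m : ℕ)
  /-- `x := y` -/
  | copy (x y : ℕ)
  /-- `x := x + 1` -/
  | succ (x : ℕ)
  /-- `x := x - 1`, and `0` stays `0` -/
  | pred (x : ℕ)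
  /-- `x := a[i, j]` -/
  | load (x a i j : ℕ)
  /-- `a[i, j] := x` -/
  | store (a i j x : ℕ)
  /-- first `p`, then `q` -/
  | seq (p q : RamProgram)
  /-- if `b` then `p` else `q` -/
  | branch (b : RamTest) (p q : RamProgram)
  /-- while `b` do `p` -/
  | loop (b : RamTest) (p : RamProgram)

namespace RamState

/-- Overwrite the register `x` by `m`. -/
def setReg (σ : RamState) (x m : ℕ) : RamState :=
  { σ with reg := Function.update σ.reg x m }

/-- Overwrite the entry `(i, j)` of the array `a` by `m`. -/
def setArr (σ : RamState) (a i j m : ℕ) : RamState :=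
  { σ with
    arr := Function.update σ.arr a
      (Function.update (σ.arr a) i (Function.update (σ.arr a i) j m)) }

end RamState

/-- `RamProgram.Runs p σ t σ'`: started in `σ`, the program `p` halts after exactly `t` steps with
the memory in state `σ'`. Every elementary instruction and every evaluation of a test is a step. -/
inductive RamProgram.Runs : RamProgram → RamState → ℕ → RamState → Prop
  | skip (σ) : Runs .skip σ 1 σ
  | const (x m σ) : Runs (.const x m) σ 1 (σ.setReg x m)
  | copy (x y σ) : Runs (.copy x y) σ 1 (σ.setReg x (σ.reg y))
  | succ (x σ) : Runs (.succ x) σ 1 (σ.setReg x (σ.reg x + 1))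
  | pred (x σ) : Runs (.pred x) σ 1 (σ.setReg x (σ.reg x - 1))
  | load (x a i j σ) :
      Runs (.load x a i j) σ 1 (σ.setReg x (σ.arr a (σ.reg i) (σ.reg j)))
  | store (a i j x σ) :
      Runs (.store a i j x) σ 1 (σ.setArr a (σ.reg i) (σ.reg j) (σ.reg x))
  | seq {p q σ₁ σ₂ σ₃ t₁ t₂} :
      Runs p σ₁ t₁ σ₂ → Runs q σ₂ t₂ σ₃ → Runs (.seq p q) σ₁ (t₁ + t₂) σ₃
  | branch_true {b p q σ σ' t} :
      b.Holds σ → Runs p σ t σ' → Runs (.branch b p q) σ (1 + t) σ'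
  | branch_false {b p q σ σ' t} :
      ¬ b.Holds σ → Runs q σ t σ' → Runs (.branch b p q) σ (1 + t) σ'
  | loop_true {b p σ₁ σ₂ σ₃ t₁ t₂} :
      b.Holds σ₁ → Runs p σ₁ t₁ σ₂ → Runs (.loop b p) σ₂ t₂ σ₃ →
      Runs (.loop b p) σ₁ (1 + t₁ + t₂) σ₃
  | loop_false {b p σ} : ¬ b.Holds σ → Runs (.loop b p) σ 1 σ

/-! ## Input and output -/

/-- The `0`-`1` table of a family of vertex sets: entry `(i, v)` tells whether `v ∈ A i`. It is `0`
outside of the range of the indices. -/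
def membershipTable {m n : ℕ} (A : Fin m → Finset (Fin n)) (i v : ℕ) : ℕ :=
  if h : i < m ∧ v < n then (if (⟨v, h.2⟩ : Fin n) ∈ A ⟨i, h.1⟩ then 1 else 0) else 0

/-- The initial memory for a graph with vertices `0, …, n - 1`, the preprocessed data `D` and the
sets `S 0, …, S (k - 1)`. Registers `0`, `1`, `2` hold `n`, `k` and the root of the tree. Array `0`
holds in its row `0` the parents in the tree, array `1` the membership table of the opposite SCs,
and array `2` the membership table of the sets `S i`. Everything else is `0`. -/
def initialState {n k : ℕ} {G : WeightedGraph (Fin n)} (D : Preprocessed G)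
    (S : Fin k → Finset (Fin n)) : RamState where
  reg x := if x = 0 then n else if x = 1 then k else if x = 2 then D.root else 0
  arr a :=
    if a = 0 then fun i v => if h : i = 0 ∧ v < n then D.parent ⟨v, h.2⟩ else 0
    else if a = 1 then membershipTable D.opposite
    else if a = 2 then membershipTable S
    else fun _ _ => 0

/-- Row `0` of array `3` holds a coloring of the vertices `0, …, n - 1` whose color classes are the
clusters of `Ω`. -/
def EncodesClustering {n : ℕ} (σ : RamState) (Ω : WeightedGraph.Clustering (Fin n)) : Prop :=
  ∀ u v : Fin n, σ.arr 3 0 u = σ.arr 3 0 v ↔ ∃ C ∈ Ω.parts, u ∈ C ∧ v ∈ C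

/-! Write c(X) for the cost of the cut between X and its complement. Everything rests on uncrossing:
c is submodular, and, being symmetric, it also satisfies c(A \ B) + c(B \ A) ≤ c(A) + c(B). A set S
is an SC with source s exactly if S is the strict minimum of c among the subsets of S that contain s
(`isSCOf_iff`). Uncrossing then shows that two intersecting SCs have an SC as their union
(`IsSC.union`). Hence the maximal SCs disjoint from S partition the complement of S, and together
with S they form Ω(S). The overlay clustering is the common refinement of the Ω(S_i).

For the algorithm, Ω(S) must be read off the cut tree in linear time. The subtree below c is maximal
among the SCs that avoid the parent of c (`Preprocessed.subset_subtree`), and the opposite SC of s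
is maximal among the SCs that avoid s (`Preprocessed.subset_opposite`). Moreover, an SC S is
connected in the tree, so it has a top vertex a and lies below it. The clusters of Ω(S) other than S
are then of two kinds. Those that contain a proper ancestor of a are opposite SCs of vertices x on
the path from a to the root: walking up, x stays the label until the parent of the current vertex p
leaves the opposite SC of x, and then p becomes the label. The others are subtrees of vertices off
the path. A vertex off the path and outside S heads such a subtree cluster or belongs to the cluster
of its parent, and one lookup in the tables decides which.

This gives each vertex a color in O(n) steps per set. The common refinement is kept by renaming
pairs of an old and a new color through a two-dimensional table, again in O(n) steps. After k rounds
the total is O(kn). -/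

namespace WeightedGraph

/-! ### Uncrossing for the cut function, and unions of source communities. -/

section Cut

variable {V : Type*} (G : WeightedGraph V)

theorem weight_nonneg (u v : V) : 0 ≤ G.weight u v := by
  unfold weight
  split_ifs with h
  · exact (G.cost_pos _ h).le
  · exact le_rfl

theorem weight_comm (u v : V) : G.weight u v = G.weight v u := by
  rw [weight, weight, Sym2.eq_swap]
  by_cases h : G.Adj u v
  · rw [if_pos h, if_pos h.symm]
  · rw [if_neg h, if_neg fun h' => h h'.symm]

theorem cutCost_comm (A B : Finset V) : G.cutCost A B = G.cutCost B A := by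
  unfold cutCost
  rw [Finset.sum_comm]
  exact Finset.sum_congr rfl fun _ _ => Finset.sum_congr rfl fun _ _ => G.weight_comm _ _

variable [Fintype V] [DecidableEq V]

/-- The cost of the cut with sides `X` and `Xᶜ`. -/
noncomputable def cut (X : Finset V) : ℝ := G.cutCost X Xᶜ

theorem cut_compl (X : Finset V) : G.cut Xᶜ = G.cut X := by
  rw [cut, cut, compl_compl, cutCost_comm]

theorem cutCost_eq_sum (A B : Finset V) :
    G.cutCost A B = ∑ a, ∑ b, if a ∈ A ∧ b ∈ B then G.weight a b else 0 := by
  simp only [cutCost, ite_and, Finset.sum_ite_irrel, Finset.sum_const_zero, Finset.sum_ite_mem,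
    Finset.univ_inter]

theorem cut_inter_add_cut_union_le (A B : Finset V) :
    G.cut (A ∩ B) + G.cut (A ∪ B) ≤ G.cut A + G.cut B := by
  simp only [cut, cutCost_eq_sum, ← Finset.sum_add_distrib]
  refine Finset.sum_le_sum fun a _ => Finset.sum_le_sum fun b _ => ?_
  have := G.weight_nonneg a b
  simp only [Finset.mem_inter, Finset.mem_union, Finset.mem_compl]
  by_cases h1 : a ∈ A <;> by_cases h2 : a ∈ B <;> by_cases h3 : b ∈ A <;> by_cases h4 : b ∈ B <;>
    simp [h1, h2, h3, h4, this]

/-- Submodularity applied to A and the complement of B, since a cut costs the same from both sides.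
-/
theorem cut_sdiff_add_cut_sdiff_le (A B : Finset V) :
    G.cut (A \ B) + G.cut (B \ A) ≤ G.cut A + G.cut B := by
  have h := G.cut_inter_add_cut_union_le A Bᶜ
  rw [G.cut_compl B, ← G.cut_compl (A ∪ Bᶜ)] at h
  have h1 : A ∩ Bᶜ = A \ B := by ext; simp
  have h2 : (A ∪ Bᶜ)ᶜ = B \ A := by ext; simp [and_comm]
  rwa [h1, h2] at h

theorem cut_sdiff {S U : Finset V} (h : U ⊆ S) :
    G.cut (S \ U) = G.cut S - G.cutCost U Sᶜ + G.cutCost U (S \ U) := by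
  rw [G.cutCost_comm U (S \ U)]
  simp only [cut, cutCost_eq_sum, ← Finset.sum_add_distrib, ← Finset.sum_sub_distrib]
  refine Finset.sum_congr rfl fun a _ => Finset.sum_congr rfl fun b _ => ?_
  simp only [Finset.mem_compl, Finset.mem_sdiff]
  have ha := @h a
  have hb := @h b
  by_cases h1 : a ∈ S <;> by_cases h2 : a ∈ U <;> by_cases h3 : b ∈ S <;> by_cases h4 : b ∈ U <;>
    simp_all

/-- Moving U out of S changes the cut by c(U, S \ U) - c(U, Sᶜ), so the defining inequality says
that every S \ U that keeps s is strictly more expensive than S. All later arguments use this form.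
-/
theorem isSCOf_iff {s : V} {S : Finset V} :
    G.IsSCOf s S ↔ s ∈ S ∧ ∀ X ⊂ S, s ∈ X → G.cut S < G.cut X := by
  refine and_congr_right fun hs => ⟨fun h X hX hsX => ?_, fun h U hU hsU hne => ?_⟩
  · have h1 := h (S \ X) Finset.sdiff_subset (by simp [hsX])
      (Finset.sdiff_nonempty.2 hX.2)
    have h2 := G.cut_sdiff (Finset.sdiff_subset : S \ X ⊆ S)
    rw [Finset.sdiff_sdiff_eq_self hX.1] at h2 h1
    linarith
  · have h1 := h (S \ U) (Finset.sdiff_ssubset hU hne) (by simp [hs, hsU])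
    have h2 := G.cut_sdiff hU
    linarith

variable {G}

theorem IsSCOf.cut_inter_lt {s : V} {S X : Finset V} (h : G.IsSCOf s S) (hs : s ∈ X)
    (hX : ¬S ⊆ X) : G.cut S < G.cut (S ∩ X) :=
  (G.isSCOf_iff.1 h).2 _ (Finset.ssubset_iff_subset_ne.2
    ⟨Finset.inter_subset_left, fun e => hX (Finset.inter_eq_left.1 e)⟩)
    (Finset.mem_inter.2 ⟨h.1, hs⟩)

theorem IsSCOf.cut_inter_le {s : V} {S X : Finset V} (h : G.IsSCOf s S) (hs : s ∈ X) :
    G.cut S ≤ G.cut (S ∩ X) := by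
  by_cases hX : S ⊆ X
  · rw [Finset.inter_eq_left.2 hX]
  · exact (h.cut_inter_lt hs hX).le

theorem IsSCOf.cut_sdiff_lt {s v : V} {S X : Finset V} (h : G.IsSCOf s S) (hs : s ∉ X)
    (hS : v ∈ S) (hX : v ∈ X) : G.cut S < G.cut (S \ X) :=
  (G.isSCOf_iff.1 h).2 _ (Finset.ssubset_iff_subset_ne.2
    ⟨Finset.sdiff_subset, fun e => by
      rw [← e] at hS
      exact (Finset.mem_sdiff.1 hS).2 hX⟩)
    (Finset.mem_sdiff.2 ⟨h.1, hs⟩)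

/-- Uncrossing X with T gives c(T ∪ X) ≤ c(X), and uncrossing T ∪ X with S gives c(S ∪ T) ≤ c(T ∪
X). One of the two is strict, because X misses a vertex of T or else one of S. -/
theorem IsSCOf.union {s t : V} {S T : Finset V} (hS : G.IsSCOf s S) (hT : G.IsSCOf t T)
    (hst : s ∈ T) : G.IsSCOf t (S ∪ T) := by
  rw [isSCOf_iff]
  refine ⟨Finset.mem_union_right _ hT.1, fun X hX htX => ?_⟩
  have h1 := G.cut_inter_add_cut_union_le T X
  have h2 := hT.cut_inter_le htX
  have h3 := G.cut_inter_add_cut_union_le S (T ∪ X)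
  have h4 := hS.cut_inter_le (X := T ∪ X) (Finset.mem_union_left _ hst)
  have h5 : S ∪ (T ∪ X) = S ∪ T := by
    rw [← Finset.union_assoc]
    exact Finset.union_eq_left.2 hX.1
  rw [h5] at h3
  by_cases hTX : T ⊆ X
  · have hSX : ¬S ⊆ T ∪ X := fun h => hX.2 (Finset.union_subset
      (h.trans (Finset.union_subset hTX subset_rfl)) hTX)
    have := hS.cut_inter_lt (Finset.mem_union_left X hst) hSX
    linarith
  · have := hT.cut_inter_lt htX hTX
    linarith

theorem IsSC.union {S T : Finset V} (hS : G.IsSC S) (hT : G.IsSC T)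
    (hST : ¬Disjoint S T) : G.IsSC (S ∪ T) := by
  obtain ⟨s, hs⟩ := hS
  obtain ⟨t, ht⟩ := hT
  obtain ⟨v, hvS, hvT⟩ := Finset.not_disjoint_iff.1 hST
  by_cases h1 : s ∈ T
  · exact ⟨t, hs.union ht h1⟩
  by_cases h2 : t ∈ S
  · rw [Finset.union_comm]
    exact ⟨s, ht.union hs h2⟩
  -- Neither source lies in the other set, so both differences would cost strictly more than the
  -- sets themselves, against the second uncrossing inequality.
  · have := hs.cut_sdiff_lt h1 hvS hvT
    have := ht.cut_sdiff_lt h2 hvT hvS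
    have := G.cut_sdiff_add_cut_sdiff_le S T
    linarith

theorem IsSC.nonempty {S : Finset V} (hS : G.IsSC S) : S.Nonempty := hS.imp fun _ h => h.1

theorem isSC_singleton (v : V) : G.IsSC {v} :=
  ⟨v, by simp, fun U hU hv hne => by
    obtain ⟨u, hu⟩ := hne
    have := Finset.mem_singleton.1 (hU hu)
    exact absurd (this ▸ hu) hv⟩

end Cut

/-! ### Maximal SC clusterings and their common refinement. -/

section Clusterings

variable {V : Type*} [Fintype V] [DecidableEq V]

/-- `u` and `v` belong to the same cluster. -/
def SameCluster (Ω : Clustering V) (u v : V) : Prop := ∃ C ∈ Ω.parts, u ∈ C ∧ v ∈ C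

theorem le_iff_sameCluster {P Q : Clustering V} :
    P ≤ Q ↔ ∀ u v, SameCluster P u v → SameCluster Q u v := by
  constructor
  · rintro h u v ⟨C, hC, hu, hv⟩
    obtain ⟨D, hD, hCD⟩ := h hC
    exact ⟨D, hD, hCD hu, hCD hv⟩
  · intro h C hC
    obtain ⟨u, hu⟩ := P.nonempty_of_mem_parts hC
    obtain ⟨D, hD, huD⟩ := Q.exists_mem (Finset.mem_univ u)
    refine ⟨D, hD, fun v hv => ?_⟩
    obtain ⟨D', hD', hu', hv'⟩ := h u v ⟨C, hC, hu, hv⟩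
    rwa [Q.eq_of_mem_parts hD hD' huD hu']

theorem exists_clustering (r : Setoid V) :
    ∃ Ω : Clustering V, ∀ u v, SameCluster Ω u v ↔ r u v := by
  classical
  refine ⟨Finpartition.ofSetoid r, fun u v => ?_⟩
  rw [← Finpartition.mem_part_ofSetoid_iff_rel, Finpartition.mem_part_iff_exists]
  exact exists_congr fun C => and_congr_right fun _ => and_comm

theorem sameCluster_equivalence (Ω : Clustering V) : Equivalence (SameCluster Ω) where
  refl u := by
    obtain ⟨D, hD, hu⟩ := Ω.exists_mem (Finset.mem_univ u)
    exact ⟨D, hD, hu, hu⟩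
  symm := fun ⟨D, hD, hu, hv⟩ => ⟨D, hD, hv, hu⟩
  trans := by
    rintro u v w ⟨D, hD, hu, hv⟩ ⟨E, hE, hv', hw⟩
    obtain rfl := Ω.eq_of_mem_parts hD hE hv hv'
    exact ⟨D, hD, hu, hw⟩

theorem mem_parts_iff_sameCluster {Ω : Clustering V} {C : Finset V} :
    C ∈ Ω.parts ↔ C.Nonempty ∧ ∀ u ∈ C, ∀ v, SameCluster Ω u v ↔ v ∈ C := by
  constructor
  · intro hC
    refine ⟨Ω.nonempty_of_mem_parts hC, fun u hu v => ⟨?_, fun hv => ⟨C, hC, hu, hv⟩⟩⟩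
    rintro ⟨D, hD, hu', hv'⟩
    rwa [Ω.eq_of_mem_parts hC hD hu hu']
  · rintro ⟨⟨u, hu⟩, h⟩
    obtain ⟨D, hD, huD⟩ := Ω.exists_mem (Finset.mem_univ u)
    have : C = D := by
      ext v
      rw [← h u hu v]
      constructor
      · rintro ⟨E, hE, hu', hv'⟩
        rwa [Ω.eq_of_mem_parts hD hE huD hu']
      · exact fun hv => ⟨D, hD, huD, hv⟩
    rwa [this]

variable (G : WeightedGraph V)

/-- `C` is maximal among the SCs that are disjoint from `S`. -/
def IsMaxAway (S C : Finset V) : Prop :=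
  G.IsSC C ∧ Disjoint C S ∧ ∀ N, G.IsSC N → Disjoint N S → ¬Disjoint N C → N ⊆ C

/-- A candidate of largest cardinality absorbs every SC that meets it and avoids S, since the union
is again a candidate. The singleton of v shows that there is one. -/
theorem exists_isMaxAway {S : Finset V} {v : V} (hv : v ∉ S) : ∃ C, G.IsMaxAway S C ∧ v ∈ C := by
  classical
  obtain ⟨C, hC, hmax⟩ := (Finset.univ.filter fun C : Finset V =>
    G.IsSC C ∧ Disjoint C S ∧ v ∈ C).exists_max_image Finset.card
    ⟨{v}, by simp [isSC_singleton, hv]⟩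
  simp only [Finset.mem_filter, Finset.mem_univ, true_and] at hC hmax
  refine ⟨C, ⟨hC.1, hC.2.1, fun N hN hNS hNC => ?_⟩, hC.2.2⟩
  have h := hmax (N ∪ C) ⟨hN.union hC.1 hNC, Finset.disjoint_union_left.2 ⟨hNS, hC.2.1⟩,
    Finset.mem_union_right _ hC.2.2⟩
  have := Finset.eq_of_subset_of_card_le Finset.subset_union_right h
  rw [this]
  exact Finset.subset_union_left

variable {G}

theorem IsMaxAway.eq {S C D : Finset V} {v : V} (hC : G.IsMaxAway S C) (hD : G.IsMaxAway S D)
    (h1 : v ∈ C) (h2 : v ∈ D) : C = D :=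
  (hD.2.2 C hC.1 hC.2.1 (Finset.not_disjoint_iff.2 ⟨v, h1, h2⟩)).antisymm
    (hC.2.2 D hD.1 hD.2.1 (Finset.not_disjoint_iff.2 ⟨v, h2, h1⟩))

variable (G)

theorem exists_clustering_isMaxAway {S : Finset V} (hS : G.IsSC S) :
    ∃ Ω : Clustering V, ∀ C, C ∈ Ω.parts ↔ C = S ∨ G.IsMaxAway S C := by
  let r : Setoid V :=
    { r := fun u v => ∃ C, (C = S ∨ G.IsMaxAway S C) ∧ u ∈ C ∧ v ∈ C
      iseqv :=
        { refl := fun u => by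
            by_cases hu : u ∈ S
            · exact ⟨S, Or.inl rfl, hu, hu⟩
            · obtain ⟨C, hC, huC⟩ := G.exists_isMaxAway hu
              exact ⟨C, Or.inr hC, huC, huC⟩
          symm := fun ⟨C, hC, hu, hv⟩ => ⟨C, hC, hv, hu⟩
          trans := by
            rintro u v w ⟨C, hC, hu, hv⟩ ⟨D, hD, hv', hw⟩
            rcases hC with rfl | hC <;> rcases hD with rfl | hD
            · exact ⟨_, Or.inl rfl, hu, hw⟩
            · exact absurd hv (Finset.disjoint_left.1 hD.2.1 hv')
            · exact absurd hv' (Finset.disjoint_left.1 hC.2.1 hv)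
            · obtain rfl := hC.eq hD hv hv'
              exact ⟨_, Or.inr hC, hu, hw⟩ } }
  obtain ⟨Ω, hΩ⟩ := exists_clustering r
  have key : ∀ C, C = S ∨ G.IsMaxAway S C → C ∈ Ω.parts := by
    intro C hC
    rw [mem_parts_iff_sameCluster]
    refine ⟨?_, fun u hu v => ?_⟩
    · rcases hC with rfl | hC
      · exact hS.nonempty
      · exact hC.1.nonempty
    · rw [hΩ]
      refine ⟨?_, fun hv => ⟨C, hC, hu, hv⟩⟩
      rintro ⟨D, hD, hu', hv⟩
      rcases hC with rfl | hC <;> rcases hD with rfl | hD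
      · exact hv
      · exact absurd hu (Finset.disjoint_left.1 hD.2.1 hu')
      · exact absurd hu' (Finset.disjoint_left.1 hC.2.1 hu)
      · rwa [hC.eq hD hu hu']
  refine ⟨Ω, fun C => ⟨fun hC => ?_, key C⟩⟩
  obtain ⟨u, hu⟩ := Ω.nonempty_of_mem_parts hC
  obtain ⟨D, hD, huD, -⟩ := (hΩ u u).1 ⟨C, hC, hu, hu⟩
  rwa [Ω.eq_of_mem_parts hC (key D hD) hu huD]

theorem isMaxSCClustering_of_parts {S : Finset V} (hS : G.IsSC S) {Ω : Clustering V}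
    (hΩ : ∀ C, C ∈ Ω.parts ↔ C = S ∨ G.IsMaxAway S C) : G.IsMaxSCClustering S Ω := by
  refine ⟨⟨(hΩ S).2 (Or.inl rfl), fun C hC => ?_⟩, ?_⟩
  · rcases (hΩ C).1 hC with rfl | h
    · exact hS
    · exact h.1
  · rintro Ω' ⟨hSΩ', hΩ'⟩ C hC
    by_cases hCS : C = S
    · exact ⟨S, (hΩ S).2 (Or.inl rfl), hCS.le⟩
    · have hdisj : Disjoint C S := Ω'.disjoint hC hSΩ' hCS
      obtain ⟨u, hu⟩ := Ω'.nonempty_of_mem_parts hC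
      obtain ⟨D, hD, huD⟩ := G.exists_isMaxAway (Finset.disjoint_left.1 hdisj hu)
      exact ⟨D, (hΩ D).2 (Or.inr hD), hD.2.2 C (hΩ' C hC) hdisj
        (Finset.not_disjoint_iff.2 ⟨u, hu, huD⟩)⟩

theorem existsUnique_isMaxSCClustering {S : Finset V} (hS : G.IsSC S) :
    ∃! Ω : Clustering V, G.IsMaxSCClustering S Ω := by
  obtain ⟨Ω, hΩ⟩ := G.exists_clustering_isMaxAway hS
  exact ⟨Ω, G.isMaxSCClustering_of_parts hS hΩ,
    fun Ω' h' => h'.unique (G.isMaxSCClustering_of_parts hS hΩ)⟩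

variable {G}

theorem IsMaxSCClustering.mem_parts_iff {S : Finset V} (hS : G.IsSC S) {Ω : Clustering V}
    (h : G.IsMaxSCClustering S Ω) (C : Finset V) :
    C ∈ Ω.parts ↔ C = S ∨ G.IsMaxAway S C := by
  obtain ⟨Ω', hΩ'⟩ := G.exists_clustering_isMaxAway hS
  rw [h.unique (G.isMaxSCClustering_of_parts hS hΩ')]
  exact hΩ' C

variable (G)

/-- The common refinement of the maximal SC clusterings is the greatest clustering that is nested
in all of them. -/
theorem exists_isGreatest_nestedInAll {k : ℕ} (S : Fin k → Finset V) :
    ∃ Ω : Clustering V, IsGreatest {Ω' | G.NestedInAll S Ω'} Ω ∧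
      ∀ u v, SameCluster Ω u v ↔
        ∀ i, ∀ Ωi : Clustering V, G.IsMaxSCClustering (S i) Ωi → SameCluster Ωi u v := by
  let r : Setoid V :=
    { r := fun u v => ∀ i, ∀ Ωi : Clustering V, G.IsMaxSCClustering (S i) Ωi → SameCluster Ωi u v
      iseqv :=
        { refl := fun u i Ωi _ => (sameCluster_equivalence Ωi).refl u
          symm := fun h i Ωi hi => (sameCluster_equivalence Ωi).symm (h i Ωi hi)
          trans := fun h h' i Ωi hi => (sameCluster_equivalence Ωi).trans (h i Ωi hi)
            (h' i Ωi hi) } }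
  obtain ⟨Ω, hΩ⟩ := exists_clustering r
  refine ⟨Ω, ⟨fun i Ωi hi => le_iff_sameCluster.2 fun u v h => (hΩ u v).1 h i Ωi hi,
    fun Ω' hΩ' => le_iff_sameCluster.2 fun u v h => (hΩ u v).2 fun i Ωi hi => ?_⟩, hΩ⟩
  exact le_iff_sameCluster.1 (hΩ' i Ωi hi) u v h

variable {G}

theorem IsOverlayClustering.isGreatest {k : ℕ} {S : Fin k → Finset V} {Ω : Clustering V}
    (h : G.IsOverlayClustering S Ω) :
    IsGreatest {Ω' | G.NestedInAll S Ω'} Ω := by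
  obtain ⟨Ω', hΩ', -⟩ := G.exists_isGreatest_nestedInAll S
  rwa [h.eq_of_le hΩ'.1 (hΩ'.2 h.1)]

theorem IsOverlayClustering.sameCluster_iff {k : ℕ} {S : Fin k → Finset V}
    (hS : ∀ i, G.IsSC (S i)) {Ω : Clustering V} (h : G.IsOverlayClustering S Ω) (u v : V) :
    SameCluster Ω u v ↔ ∀ i, ∃ C, (C = S i ∨ G.IsMaxAway (S i) C) ∧ u ∈ C ∧ v ∈ C := by
  obtain ⟨Ω', hΩ', h'⟩ := G.exists_isGreatest_nestedInAll S
  rw [h.isGreatest.unique hΩ', h']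
  refine forall_congr' fun i => ?_
  obtain ⟨Ωi, hi, huniq⟩ := G.existsUnique_isMaxSCClustering (hS i)
  constructor
  · intro H
    obtain ⟨C, hC, huv⟩ := H Ωi hi
    exact ⟨C, (hi.mem_parts_iff (hS i) C).1 hC, huv⟩
  · rintro ⟨C, hC, huv⟩ Ω'' h''
    exact ⟨C, (h''.mem_parts_iff (hS i) C).2 hC, huv⟩

variable (G)

theorem existsUnique_isOverlayClustering {k : ℕ} (S : Fin k → Finset V) :
    ∃! Ω : Clustering V, G.IsOverlayClustering S Ω := by
  obtain ⟨Ω, hΩ, -⟩ := G.exists_isGreatest_nestedInAll S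
  exact ⟨Ω, hΩ.maximal, fun Ω' h' => h'.isGreatest.unique hΩ⟩

variable {G}

/-- Ω(S i) separates S i from the rest. No other Ω(S j) splits it, because S i is an SC disjoint
from S j and hence lies in one maximal such SC. -/
theorem IsOverlayClustering.mem_parts {k : ℕ} {S : Fin k → Finset V} (hS : ∀ i, G.IsSC (S i))
    (hdisj : Pairwise fun i j => Disjoint (S i) (S j)) {Ω : Clustering V}
    (h : G.IsOverlayClustering S Ω) (i : Fin k) : S i ∈ Ω.parts := by
  rw [mem_parts_iff_sameCluster]
  refine ⟨(hS i).nonempty, fun u hu v => ?_⟩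
  rw [h.sameCluster_iff hS]
  constructor
  · intro H
    obtain ⟨C, hC, huC, hvC⟩ := H i
    rcases hC with rfl | hC
    · exact hvC
    · exact absurd hu (Finset.disjoint_left.1 hC.2.1 huC)
  · intro hv j
    by_cases hij : i = j
    · subst hij
      exact ⟨S i, Or.inl rfl, hu, hv⟩
    · obtain ⟨C, hC, huC⟩ := G.exists_isMaxAway (Finset.disjoint_left.1 (hdisj hij) hu)
      exact ⟨C, Or.inr hC, huC,
        hC.2.2 _ (hS i) (hdisj hij) (Finset.not_disjoint_iff.2 ⟨u, hu, huC⟩) hv⟩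

theorem IsOverlayClustering.le_of_isSCClustering {k : ℕ} {S : Fin k → Finset V}
    {Ω : Clustering V} (h : G.IsOverlayClustering S Ω) {Ω' : Clustering V}
    (hΩ' : G.IsSCClustering Ω') (hmem : ∀ i, S i ∈ Ω'.parts) : Ω' ≤ Ω :=
  h.isGreatest.2 fun i _ hi => hi.2 ⟨hmem i, hΩ'⟩

end Clusterings

end WeightedGraph

/-! ### The sets SC(s, t) as extremal minimum cuts. -/

namespace WeightedGraph

variable {V : Type*} [Fintype V] [DecidableEq V] {G : WeightedGraph V}

namespace IsSCWrt

variable {s t : V} {S X : Finset V}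

theorem mem (h : G.IsSCWrt s {t} S) : s ∈ S := h.1.1.1

theorem notMem (h : G.IsSCWrt s {t} S) : t ∉ S := Finset.disjoint_singleton_right.1 h.1.1.2

theorem cut_le (h : G.IsSCWrt s {t} S) (hs : s ∈ X) (ht : t ∉ X) : G.cut S ≤ G.cut X :=
  h.1.2 X ⟨hs, Finset.disjoint_singleton_right.2 ht⟩

theorem cut_le' (h : G.IsSCWrt s {t} S) (hs : s ∉ X) (ht : t ∈ X) : G.cut S ≤ G.cut X := by
  rw [← G.cut_compl X]
  exact h.cut_le (by simpa using hs) (by simpa using ht)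

/-- By submodularity S ∩ X is a minimum cut side too, so fewest vertices amounts to least under
inclusion. -/
theorem subset (h : G.IsSCWrt s {t} S) (hs : s ∈ X) (ht : t ∉ X) (hX : G.cut X ≤ G.cut S) :
    S ⊆ X := by
  have h1 := G.cut_inter_add_cut_union_le S X
  have h2 := h.cut_le (X := S ∪ X) (Finset.mem_union_right _ hs) (by simp [h.notMem, ht])
  have h3 : G.cut (S ∩ X) ≤ G.cut S := by linarith
  have h4 := h.2 (S ∩ X) ⟨⟨Finset.mem_inter.2 ⟨h.mem, hs⟩, by simp [ht]⟩,
    fun S' hS' => h3.trans (h.1.2 S' hS')⟩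
  exact Finset.inter_eq_left.1 (Finset.eq_of_subset_of_card_le Finset.inter_subset_left h4)

theorem isSCOf (h : G.IsSCWrt s {t} S) : G.IsSCOf s S := by
  refine G.isSCOf_iff.2 ⟨h.mem, fun X hX hs => ?_⟩
  by_contra! hle
  exact hX.2 (h.subset hs (fun ht => h.notMem (hX.1 ht)) hle)

theorem isSC (h : G.IsSCWrt s {t} S) : G.IsSC S := ⟨s, h.isSCOf⟩

/-- Otherwise N ∩ S costs more than N, and submodularity makes N ∪ S a cheaper s-t-cut than S. -/
theorem subset_of_isSCOf {N : Finset V} (h : G.IsSCWrt s {t} S) (hN : G.IsSCOf s N) (ht : t ∉ N) :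
    N ⊆ S := by
  by_contra hNS
  have h1 := hN.cut_inter_lt h.mem hNS
  have h2 := G.cut_inter_add_cut_union_le N S
  have h3 := h.cut_le (X := N ∪ S) (Finset.mem_union_right _ h.mem) (by simp [h.notMem, ht])
  linarith

end IsSCWrt

variable (G) in
theorem exists_isSCWrt {s t : V} (hst : s ≠ t) : ∃ S, G.IsSCWrt s {t} S := by
  classical
  obtain ⟨A, hA, hAmin⟩ := (Finset.univ.filter fun S : Finset V =>
    Separates s {t} S).exists_min_image G.cut ⟨{s}, by simp [Separates, hst.symm]⟩
  simp only [Finset.mem_filter, Finset.mem_univ, true_and] at hA hAmin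
  obtain ⟨B, hB, hBmin⟩ := (Finset.univ.filter fun S : Finset V =>
    G.IsMinCutSide s {t} S).exists_min_image Finset.card
      ⟨A, Finset.mem_filter.2 ⟨Finset.mem_univ _, hA, hAmin⟩⟩
  simp only [Finset.mem_filter, Finset.mem_univ, true_and] at hB hBmin
  exact ⟨B, hB, hBmin⟩

end WeightedGraph

/-! ### Ancestors and subtrees in a rooted tree. -/

namespace ParentTree

variable {V : Type*} [Fintype V] (T : ParentTree V) {u v w : V}

theorem mem_subtree : u ∈ T.subtree v ↔ ∃ i : ℕ, T.parent^[i] u = v := by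
  simp [subtree]

theorem self_mem_subtree (v : V) : v ∈ T.subtree v := T.mem_subtree.2 ⟨0, rfl⟩

theorem mem_subtree_root (v : V) : v ∈ T.subtree T.root := T.mem_subtree.2 (T.reaches_root v)

omit [Fintype V] in
theorem iterate_root (i : ℕ) : T.parent^[i] T.root = T.root :=
  Function.iterate_fixed T.parent_root i

variable {T}

theorem mem_subtree_trans (h1 : u ∈ T.subtree v) (h2 : v ∈ T.subtree w) : u ∈ T.subtree w := by
  obtain ⟨i, rfl⟩ := T.mem_subtree.1 h1
  obtain ⟨j, rfl⟩ := T.mem_subtree.1 h2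
  exact T.mem_subtree.2 ⟨j + i, Function.iterate_add_apply _ _ _ _⟩

theorem mem_subtree_of_parent (h : T.parent u ∈ T.subtree v) : u ∈ T.subtree v := by
  obtain ⟨i, hi⟩ := T.mem_subtree.1 h
  exact T.mem_subtree.2 ⟨i + 1, hi⟩

variable (T) in
theorem mem_subtree_parent (v : V) : v ∈ T.subtree (T.parent v) :=
  mem_subtree_of_parent (T.self_mem_subtree _)

theorem parent_mem_subtree (h : u ∈ T.subtree v) (hne : u ≠ v) : T.parent u ∈ T.subtree v := by
  obtain ⟨i, hi⟩ := T.mem_subtree.1 h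
  cases i with
  | zero => exact absurd hi hne
  | succ i => exact T.mem_subtree.2 ⟨i, hi⟩

theorem exists_child (h : u ∈ T.subtree v) (hne : u ≠ v) :
    ∃ c, c ≠ T.root ∧ T.parent c = v ∧ u ∈ T.subtree c := by
  classical
  have h := T.mem_subtree.1 h
  obtain ⟨i, hi⟩ : ∃ i, Nat.find h = i + 1 :=
    Nat.exists_eq_succ_of_ne_zero fun h0 => hne (by simpa [h0] using Nat.find_spec h)
  have hspec := Nat.find_spec h
  rw [hi, Function.iterate_succ_apply'] at hspec
  -- Minimality of the path length excludes the root: it is its own parent, so v would have been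
  -- reached one step earlier.
  refine ⟨T.parent^[i] u, fun hr => ?_, hspec, T.mem_subtree.2 ⟨i, rfl⟩⟩
  refine Nat.find_min h (m := i) (by omega) ?_
  rw [← hspec, hr, T.parent_root]

theorem mem_subtree_total (h1 : u ∈ T.subtree v) (h2 : u ∈ T.subtree w) :
    v ∈ T.subtree w ∨ w ∈ T.subtree v := by
  obtain ⟨i, rfl⟩ := T.mem_subtree.1 h1
  obtain ⟨j, rfl⟩ := T.mem_subtree.1 h2
  simp only [T.mem_subtree, ← Function.iterate_add_apply]
  rcases le_total i j with h | h
  · exact Or.inl ⟨j - i, by rw [Nat.sub_add_cancel h]⟩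
  · exact Or.inr ⟨i - j, by rw [Nat.sub_add_cancel h]⟩

/-- A path that enters a set from outside has a first edge into the set. -/
theorem exists_entering_edge {S : Set V} (h : u ∈ T.subtree w) (hu : u ∉ S) (hw : w ∈ S) :
    ∃ c, c ≠ T.root ∧ c ∉ S ∧ T.parent c ∈ S ∧ u ∈ T.subtree c ∧ c ∈ T.subtree w := by
  obtain ⟨i, hi⟩ := T.mem_subtree.1 h
  induction i generalizing u with
  | zero => exact absurd (hi.symm ▸ hw : T.parent^[0] u ∈ S) hu
  | succ i ih =>
    by_cases hp : T.parent u ∈ S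
    · refine ⟨u, fun hr => hu ?_, hu, hp, T.self_mem_subtree u, h⟩
      rwa [hr, T.parent_root, ← hr] at hp
    · obtain ⟨c, h1, h2, h3, h4, h5⟩ := ih (T.mem_subtree.2 ⟨i, hi⟩) hp hi
      exact ⟨c, h1, h2, h3, mem_subtree_of_parent h4, h5⟩

end ParentTree

/-! ### The clusters of Ω(S) in the cut tree. -/

namespace Preprocessed

open WeightedGraph

variable {V : Type*} [Fintype V] [DecidableEq V] {G : WeightedGraph V} (D : Preprocessed G)
variable {u v c s t : V} {N : Finset V}

theorem parent_notMem_subtree (h : s ≠ D.root) : D.parent s ∉ D.subtree s :=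
  (D.subtree_isSC s h).notMem

theorem subtree_antisymm (h1 : u ∈ D.subtree v) (h2 : v ∈ D.subtree u) : u = v := by
  by_contra hne
  have hv : v ≠ D.root := by
    rintro rfl
    obtain ⟨i, hi⟩ := D.mem_subtree.1 h2
    rw [D.iterate_root] at hi
    exact hne hi.symm
  exact D.parent_notMem_subtree hv
    (ParentTree.mem_subtree_trans (ParentTree.parent_mem_subtree h2 (Ne.symm hne)) h1)

/-- The subtrees of the children of a vertex are disjoint. -/
theorem eq_of_mem_subtree_of_parent_eq (hs : s ≠ D.root) (ht : t ≠ D.root)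
    (hst : D.parent s = D.parent t) (h1 : u ∈ D.subtree s) (h2 : u ∈ D.subtree t) : s = t := by
  by_contra hne
  rcases ParentTree.mem_subtree_total h1 h2 with h | h
  · exact D.parent_notMem_subtree ht (hst ▸ ParentTree.parent_mem_subtree h hne)
  · exact D.parent_notMem_subtree hs (hst ▸ ParentTree.parent_mem_subtree h (Ne.symm hne))

/-- The subtree below `c` is maximal among the SCs that avoid the parent of `c`. -/
theorem subset_subtree (hc : c ≠ D.root) (hN : G.IsSC N) (hp : D.parent c ∉ N)
    (hne : ¬Disjoint N (D.subtree c)) : N ⊆ D.subtree c := by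
  have hC := D.subtree_isSC c hc
  set C := D.subtree c with hCdef
  suffices hsub : N ∪ C ⊆ C from Finset.subset_union_left.trans hsub
  obtain ⟨q, hq⟩ := hN.union hC.isSC hne
  have hp' : D.parent c ∉ N ∪ C := by simp [hp, hC.notMem]
  have hcM : c ∈ N ∪ C := Finset.mem_union_right _ hC.mem
  have hCM : C ⊆ N ∪ C := Finset.subset_union_right
  clear_value C
  generalize N ∪ C = M at *
  -- if the source lies below a child of the parent of `c`, then so does all of `M`
  have key : ∀ d, d ≠ D.root → D.parent d = D.parent c → q ∈ D.subtree d → M ⊆ D.subtree d := by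
    intro d hd hdc hqd
    by_contra hMD
    have h1 := hq.cut_inter_lt hqd hMD
    have h2 := G.cut_inter_add_cut_union_le M (D.subtree d)
    have hD := D.subtree_isSC d hd
    have h3 := hD.cut_le (X := M ∪ D.subtree d) (Finset.mem_union_right _ hD.mem)
      (by simp only [Finset.mem_union, not_or]; exact ⟨hdc ▸ hp', hD.notMem⟩)
    linarith
  by_cases hqp : q ∈ D.subtree (D.parent c)
  · obtain ⟨d, hd, hdc, hqd⟩ := ParentTree.exists_child hqp fun h => hp' (h ▸ hq.1)
    have hM := key d hd hdc hqd
    have : d = c := D.eq_of_mem_subtree_of_parent_eq hd hc hdc (hM hcM) (D.self_mem_subtree c)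
    rw [hCdef, ← this]
    exact hM
  -- The source is outside the subtree B of the parent of c, so M \ B costs more than M. Uncrossing
  -- makes B \ M cheaper than B, although it still separates that parent from its own parent.
  · exfalso
    have hr : D.parent c ≠ D.root := fun h => hqp (h ▸ D.mem_subtree_root q)
    have hB := D.subtree_isSC _ hr
    have h1 := hq.cut_sdiff_lt hqp hcM (D.mem_subtree_parent c)
    have h2 := hB.cut_le (X := D.subtree (D.parent c) \ M) (Finset.mem_sdiff.2 ⟨hB.mem, hp'⟩)
      (fun h => hB.notMem (Finset.mem_sdiff.1 h).1)
    have h3 := G.cut_sdiff_add_cut_sdiff_le M (D.subtree (D.parent c))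
    linarith

/-- The opposite SC of `s` is maximal among the SCs that avoid `s`. -/
theorem subset_opposite (hs : s ≠ D.root) (hN : G.IsSC N) (hsN : s ∉ N)
    (hne : ¬Disjoint N (D.opposite s)) : N ⊆ D.opposite s := by
  have hA := D.opposite_isSC s hs
  have hZ := D.subtree_isSC s hs
  have hpZ := hZ.notMem
  have hZA : G.cut (D.subtree s) = G.cut (D.opposite s) :=
    (hZ.cut_le' hA.notMem hA.mem).antisymm (hA.cut_le' hpZ hZ.mem)
  suffices hsub : N ∪ D.opposite s ⊆ D.opposite s from Finset.subset_union_left.trans hsub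
  obtain ⟨q, hq⟩ := hN.union hA.isSC hne
  have hsU : s ∉ N ∪ D.opposite s := by simp [hsN, hA.notMem]
  -- The union is enlarged to M = SC(q, s). Being a minimum q-s-cut side, M can be compared with the
  -- tree cuts. Suppose M is not contained in the opposite SC A. Then q lies neither in A nor below
  -- s, and M and A have the same cost.
  obtain ⟨M, hM⟩ := G.exists_isSCWrt (fun h => hsU (h ▸ hq.1) : q ≠ s)
  have hUM := hM.subset_of_isSCOf hq hsU
  have hpM : D.parent s ∈ M := hUM (Finset.mem_union_right _ hA.mem)
  have hsM := hM.notMem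
  have hqM := hM.mem
  refine hUM.trans ?_
  clear hUM hq hsU hne hsN hN
  by_contra hMA
  have hqA : q ∉ D.opposite s := by
    intro hqA
    have h1 := hM.isSCOf.cut_inter_lt hqA hMA
    have h2 := G.cut_inter_add_cut_union_le M (D.opposite s)
    have h3 := hA.cut_le (X := M ∪ D.opposite s) (Finset.mem_union_right _ hA.mem)
      (by simp [hsM, hA.notMem])
    linarith
  have hqZ : q ∉ D.subtree s := by
    intro hqZ
    obtain ⟨d, hd, hds, hqd⟩ := ParentTree.exists_child hqZ fun h => hsM (h ▸ hqM)
    have h1 := D.subset_subtree hd hM.isSC (hds ▸ hsM) (Finset.not_disjoint_iff.2 ⟨q, hqM, hqd⟩)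
    exact hpZ (ParentTree.mem_subtree_trans (h1 hpM)
      (ParentTree.mem_subtree_of_parent (hds ▸ D.self_mem_subtree s)))
  have hMcut : G.cut M = G.cut (D.opposite s) :=
    ((hM.cut_le' hqZ hZ.mem).trans hZA.le).antisymm (hA.cut_le hpM hsM)
  by_cases hqp : q ∈ D.subtree (D.parent s)
  · obtain ⟨d, hd, hdp, hqd⟩ := ParentTree.exists_child hqp fun h => hqA (h ▸ hA.mem)
    have hC := D.subtree_isSC d hd
    have hpC : D.parent s ∉ D.subtree d := hdp ▸ hC.notMem
    have hds : d ≠ s := fun h => hqZ (h ▸ hqd)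
    have hsC : s ∉ D.subtree d := fun h =>
      hds (D.eq_of_mem_subtree_of_parent_eq hd hs hdp h (D.self_mem_subtree s))
    have hdM : d ∈ M := by
      by_contra hdM
      have h1 := hC.isSCOf.cut_sdiff_lt hdM hqd hqM
      have h2 := hA.cut_le (X := M \ D.subtree d) (Finset.mem_sdiff.2 ⟨hpM, hpC⟩)
        (fun h => hsM (Finset.mem_sdiff.1 h).1)
      have h3 := G.cut_sdiff_add_cut_sdiff_le M (D.subtree d)
      linarith
    -- Here q lies below a sibling d of s. As the subtree of d costs more than A, the cut A cannot
    -- separate d from the parent, so d is in A. Uncrossing A with that subtree then yields a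
    -- contradiction.
    have hlt : G.cut (D.opposite s) < G.cut (D.subtree d) := by
      have h1 := hM.isSCOf.cut_inter_lt hqd fun h => hpC (h hpM)
      have h2 := hA.cut_le (X := M ∪ D.subtree d) (Finset.mem_union_left _ hpM)
        (by simp [hsM, hsC])
      have h3 := G.cut_inter_add_cut_union_le M (D.subtree d)
      linarith
    have hdA : d ∈ D.opposite s := by
      by_contra hdA
      have := hC.cut_le' hdA (hdp ▸ hA.mem)
      linarith
    have h1 := hC.isSCOf.cut_inter_lt hdA fun h => hqA (h hqd)
    have h2 := hA.cut_le (X := D.subtree d ∪ D.opposite s) (Finset.mem_union_right _ hA.mem)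
      (by simp [hsC, hA.notMem])
    have h3 := G.cut_inter_add_cut_union_le (D.subtree d) (D.opposite s)
    linarith
  · have hr : D.parent s ≠ D.root := fun h => hqp (h ▸ D.mem_subtree_root q)
    have hB := D.subtree_isSC _ hr
    have hsB := D.mem_subtree_parent s
    have hBM : ¬D.subtree (D.parent s) ⊆ M := fun h => hsM (h hsB)
    -- Here q lies outside the subtree B of the parent of s. If M contains the grandparent, B costs
    -- more than A, which forces the grandparent into A, and uncrossing A with B beats the minimum
    -- q-s-cut. Otherwise uncrossing B with M gives c(B) < c(M), although B separates s from q.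
    by_cases hp' : D.parent (D.parent s) ∈ M
    · have hlt : G.cut (D.opposite s) < G.cut (D.subtree (D.parent s)) := by
        have h1 := hM.isSCOf.cut_sdiff_lt hqp hpM hB.mem
        have h2 := hA.cut_le' (X := D.subtree (D.parent s) \ M) (by simp [hpM])
          (Finset.mem_sdiff.2 ⟨hsB, hsM⟩)
        have h3 := G.cut_sdiff_add_cut_sdiff_le M (D.subtree (D.parent s))
        linarith
      have hp'A : D.parent (D.parent s) ∈ D.opposite s := by
        by_contra hp'A
        have := hB.cut_le hA.mem hp'A
        linarith
      have h1 := hB.isSCOf.cut_inter_lt hA.mem fun h => hA.notMem (h hsB)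
      have h2 := hM.cut_le' (X := D.subtree (D.parent s) ∪ D.opposite s) (by simp [hqp, hqA])
        (Finset.mem_union_left _ hsB)
      have h3 := G.cut_inter_add_cut_union_le (D.subtree (D.parent s)) (D.opposite s)
      linarith
    · have h1 := hB.isSCOf.cut_inter_lt hpM hBM
      have h2 := hB.cut_le (X := D.subtree (D.parent s) ∪ M) (Finset.mem_union_right _ hpM)
        (by simp [hp', hB.notMem])
      have h3 := G.cut_inter_add_cut_union_le (D.subtree (D.parent s)) M
      have h4 := hM.cut_le' hqp hsB
      linarith

/-- SCs are connected in the tree: a downward path that leaves S does not return. A source below c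
would confine S to the subtree of one child of c; a source elsewhere is excluded by uncrossing. -/
theorem disjoint_subtree_of_parent_mem {S : Finset V} (hS : G.IsSC S) (hc : c ≠ D.root)
    (hcS : c ∉ S) (hp : D.parent c ∈ S) : Disjoint (D.subtree c) S := by
  obtain ⟨s, hs⟩ := hS
  have hC := D.subtree_isSC c hc
  by_contra hne
  obtain ⟨w, hw, hwS⟩ := Finset.not_disjoint_iff.1 hne
  by_cases hsc : s ∈ D.subtree c
  · obtain ⟨d, hd, hdc, hsd⟩ := ParentTree.exists_child hsc fun h => hcS (h ▸ hs.1)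
    have := D.subset_subtree hd ⟨s, hs⟩ (hdc ▸ hcS) (Finset.not_disjoint_iff.2 ⟨s, hs.1, hsd⟩)
    exact hC.notMem (ParentTree.mem_subtree_trans (this hp)
      (ParentTree.mem_subtree_of_parent (hdc ▸ D.self_mem_subtree c)))
  · have h1 := hs.cut_sdiff_lt hsc hwS hw
    have h2 := hC.cut_le (X := D.subtree c \ S) (Finset.mem_sdiff.2 ⟨hC.mem, hcS⟩)
      fun h => hC.notMem (Finset.mem_sdiff.1 h).1
    have h3 := G.cut_sdiff_add_cut_sdiff_le S (D.subtree c)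
    linarith

/-- `a` is the vertex of `S` that is closest to the root of the tree. -/
def IsTop (S : Finset V) (a : V) : Prop := a ∈ S ∧ (a ≠ D.root → D.parent a ∉ S)

theorem exists_isTop {S : Finset V} (hS : G.IsSC S) : ∃ a, D.IsTop S a ∧ S ⊆ D.subtree a := by
  classical
  obtain ⟨s, hs⟩ := hS
  obtain ⟨a, ha, hmax⟩ := (S.filter fun a => s ∈ D.subtree a).exists_max_image
    (fun a => (D.subtree a).card) ⟨s, by simp [hs.1, D.self_mem_subtree]⟩
  simp only [Finset.mem_filter, and_imp] at ha hmax
  have htop : a ≠ D.root → D.parent a ∉ S := by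
    intro hr hp
    have h1 : D.subtree a ⊆ D.subtree (D.parent a) := fun u hu =>
      ParentTree.mem_subtree_trans hu (D.mem_subtree_parent a)
    have h2 := Finset.eq_of_subset_of_card_le h1 (hmax _ hp (h1 ha.2))
    exact D.parent_notMem_subtree hr (h2 ▸ D.self_mem_subtree _)
  refine ⟨a, ⟨ha.1, htop⟩, ?_⟩
  by_cases hr : a = D.root
  · exact fun u _ => hr ▸ D.mem_subtree_root u
  · exact D.subset_subtree hr ⟨s, hs⟩ (htop hr) (Finset.not_disjoint_iff.2 ⟨s, hs.1, ha.2⟩)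

variable {D} {S : Finset V} {a x y : V}

theorem IsTop.subset_subtree (ha : D.IsTop S a) (hS : G.IsSC S) : S ⊆ D.subtree a := by
  obtain ⟨b, hb, hSb⟩ := D.exists_isTop hS
  suffices a = b from this ▸ hSb
  by_contra hne
  have har : a ≠ D.root := by
    rintro rfl
    obtain ⟨i, hi⟩ := D.mem_subtree.1 (hSb ha.1)
    rw [D.iterate_root] at hi
    exact hne hi
  obtain ⟨c, hc, hcS, hp, hac, -⟩ := ParentTree.exists_entering_edge (S := (S : Set V))
    (ParentTree.parent_mem_subtree (hSb ha.1) hne) (ha.2 har) hb.1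
  exact Finset.disjoint_left.1 (D.disjoint_subtree_of_parent_mem hS hc hcS hp)
    (ParentTree.mem_subtree_of_parent hac) ha.1

/-- Off the path from `S` to the root, the subtrees of the vertices outside of `S` avoid `S`. -/
theorem IsTop.disjoint_subtree (ha : D.IsTop S a) (hS : G.IsSC S) (hu : u ∉ S)
    (hau : a ∉ D.subtree u) : Disjoint (D.subtree u) S := by
  rw [Finset.disjoint_left]
  intro w hw hwS
  rcases ParentTree.mem_subtree_total hw (ha.subset_subtree hS hwS) with h | h
  · obtain ⟨c, hc, hcS, hp, huc, -⟩ := ParentTree.exists_entering_edge (S := (S : Set V)) h hu ha.1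
    exact Finset.disjoint_left.1 (D.disjoint_subtree_of_parent_mem hS hc hcS hp)
      (ParentTree.mem_subtree_trans hw huc) hwS
  · exact hau h

theorem ne_root_of_notMem_subtree (hau : a ∉ D.subtree u) : u ≠ D.root :=
  fun h => hau (h ▸ D.mem_subtree_root a)

/-- Off the path from `S` to the root, clusters are closed under taking subtrees. -/
theorem IsTop.subtree_subset (ha : D.IsTop S a) (hS : G.IsSC S) (hu : u ∉ S)
    (hau : a ∉ D.subtree u) {C : Finset V} (hC : G.IsMaxAway S C) (huC : u ∈ C) :
    D.subtree u ⊆ C :=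
  hC.2.2 _ (D.subtree_isSC u (ne_root_of_notMem_subtree hau)).isSC (ha.disjoint_subtree hS hu hau)
    (Finset.not_disjoint_iff.2 ⟨u, D.self_mem_subtree u, huC⟩)

theorem isMaxAway_subtree_of_parent_mem (hS : G.IsSC S)
    (hc : c ≠ D.root) (hcS : c ∉ S) (hp : D.parent c ∈ S) : G.IsMaxAway S (D.subtree c) :=
  ⟨(D.subtree_isSC c hc).isSC, D.disjoint_subtree_of_parent_mem hS hc hcS hp,
    fun _ hN hNS hNC => D.subset_subtree hc hN (Finset.disjoint_right.1 hNS hp) hNC⟩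

variable (D) in
theorem disjoint_subtree_opposite (hx : x ≠ D.root) :
    Disjoint (D.subtree x) (D.opposite x) := by
  have hA := D.opposite_isSC x hx
  have hZ := D.subtree_isSC x hx
  have h := hA.subset (X := (D.subtree x)ᶜ) (by simpa using hZ.notMem) (by simpa using hZ.mem) (by
    rw [G.cut_compl]
    exact hZ.cut_le' hA.notMem hA.mem)
  exact Finset.disjoint_right.2 fun u hu => Finset.mem_compl.1 (h hu)

theorem IsTop.disjoint_opposite (ha : D.IsTop S a) (hS : G.IsSC S) (hx : x ≠ D.root)
    (hax : a ∈ D.subtree x) : Disjoint (D.opposite x) S :=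
  (D.disjoint_subtree_opposite hx).symm.mono_right fun _ hu =>
    ParentTree.mem_subtree_trans (ha.subset_subtree hS hu) hax

theorem IsTop.isMaxAway_opposite (ha : D.IsTop S a) (hS : G.IsSC S) (hr : a ≠ D.root) :
    G.IsMaxAway S (D.opposite a) :=
  ⟨(D.opposite_isSC a hr).isSC, ha.disjoint_opposite hS hr (D.self_mem_subtree a),
    fun _ hN hNS hNC => D.subset_opposite hr hN (Finset.disjoint_right.1 hNS ha.1) hNC⟩

/-- This is the change of label on the path. An SC that meets the opposite SC of y and avoids S
cannot contain y: the union of the two would lie in C and put the parent of y there. Hence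
`subset_opposite` applies. -/
theorem IsTop.isMaxAway_opposite_of_parent_notMem (ha : D.IsTop S a) (hS : G.IsSC S)
    {C : Finset V} (hC : G.IsMaxAway S C) (hyC : y ∈ C) (hay : a ∈ D.subtree y)
    (hy : y ≠ D.root) (hp : D.parent y ∉ C) : G.IsMaxAway S (D.opposite y) := by
  have hA := D.opposite_isSC y hy
  refine ⟨hA.isSC, ha.disjoint_opposite hS hy hay, fun N hN hNS hNC => ?_⟩
  have hU := hN.union hA.isSC hNC
  have hyU : y ∉ N ∪ D.opposite y := fun h =>
    hp (hC.2.2 _ hU (Finset.disjoint_union_left.2 ⟨hNS, ha.disjoint_opposite hS hy hay⟩)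
      (Finset.not_disjoint_iff.2 ⟨y, h, hyC⟩) (Finset.mem_union_right _ hA.mem))
  exact D.subset_opposite hy hN (fun h => hyU (Finset.mem_union_left _ h)) hNC

/-- The downward counterpart: a vertex off the path that is not in the cluster of its parent heads a
cluster of its own. -/
theorem IsTop.isMaxAway_subtree_of_notMem (ha : D.IsTop S a) (hS : G.IsSC S)
    {C : Finset V} (hC : G.IsMaxAway S C) (hp : D.parent c ∈ C) (hcC : c ∉ C) (hcS : c ∉ S)
    (hac : a ∉ D.subtree c) : G.IsMaxAway S (D.subtree c) := by
  have hc := ne_root_of_notMem_subtree hac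
  have hdisj := ha.disjoint_subtree hS hcS hac
  refine ⟨(D.subtree_isSC c hc).isSC, hdisj, fun N hN hNS hNC => ?_⟩
  have hU := hN.union (D.subtree_isSC c hc).isSC hNC
  refine D.subset_subtree hc hN (fun h => hcC ?_) hNC
  exact hC.2.2 _ hU (Finset.disjoint_union_left.2 ⟨hNS, hdisj⟩)
    (Finset.not_disjoint_iff.2 ⟨_, Finset.mem_union_left _ h, hp⟩)
    (Finset.mem_union_right _ (D.self_mem_subtree c))

/-- The opposite SCs of the edges on a path to the root are distinct. -/
theorem eq_of_opposite_eq (hx : x ≠ D.root) (hy : y ≠ D.root) (hax : a ∈ D.subtree x)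
    (hay : a ∈ D.subtree y) (h : D.opposite x = D.opposite y) : x = y := by
  by_contra hne
  rcases ParentTree.mem_subtree_total hax hay with h' | h'
  · exact Finset.disjoint_left.1 (D.disjoint_subtree_opposite hy)
      (ParentTree.parent_mem_subtree h' hne) (h ▸ (D.opposite_isSC x hx).mem)
  · exact Finset.disjoint_left.1 (D.disjoint_subtree_opposite hx)
      (ParentTree.parent_mem_subtree h' (Ne.symm hne)) (h ▸ (D.opposite_isSC y hy).mem)

theorem subtree_ne_opposite (hx : x ≠ D.root) : D.subtree c ≠ D.opposite x := fun h =>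
  Finset.disjoint_right.1 (D.disjoint_subtree_opposite hx) (h ▸ ParentTree.mem_subtree_of_parent
    (h ▸ (D.opposite_isSC x hx).mem)) (D.self_mem_subtree x)

end Preprocessed

/-! ### Symbolic execution and running times on the machine. -/

namespace RamState

variable (σ : RamState) (x y a b i j m : ℕ)

@[simp] theorem setReg_reg : (σ.setReg x m).reg y = if y = x then m else σ.reg y := by
  simp [setReg, Function.update_apply]

@[simp] theorem setReg_arr : (σ.setReg x m).arr = σ.arr := rfl

@[simp] theorem setArr_reg : (σ.setArr a i j m).reg = σ.reg := rfl

@[simp] theorem setArr_arr : (σ.setArr a i j m).arr b =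
    if b = a then fun i' j' => if i' = i ∧ j' = j then m else σ.arr a i' j' else σ.arr b := by
  unfold setArr
  by_cases h : b = a
  · subst h
    funext i' j'
    by_cases hi : i' = i <;> by_cases hj : j' = j <;> simp [hi, hj]
  · simp [h]

end RamState

namespace RamProgram

/-- Started in `σ`, the program `p` halts, and the number of steps and the final state have the
property `Q`. -/
def Ends (p : RamProgram) (σ : RamState) (Q : ℕ → RamState → Prop) : Prop :=
  ∃ t σ', Runs p σ t σ' ∧ Q t σ'

variable {p q : RamProgram} {b : RamTest} {σ : RamState} {Q Q' : ℕ → RamState → Prop}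
variable {x y a i j m : ℕ}

theorem Ends.mono (h : Ends p σ Q) (hQ : ∀ t σ', Q t σ' → Q' t σ') : Ends p σ Q' := by
  obtain ⟨t, σ', hr, hq⟩ := h
  exact ⟨t, σ', hr, hQ _ _ hq⟩

-- This and the following equivalences form a weakest-precondition calculus, with which `simp`
-- executes loop-free programs and counts their steps.
@[simp] theorem ends_skip : Ends .skip σ Q ↔ Q 1 σ :=
  ⟨fun ⟨_, _, h, hq⟩ => by cases h; exact hq, fun h => ⟨_, _, .skip _, h⟩⟩

@[simp] theorem ends_const : Ends (.const x m) σ Q ↔ Q 1 (σ.setReg x m) :=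
  ⟨fun ⟨_, _, h, hq⟩ => by cases h; exact hq, fun h => ⟨_, _, .const _ _ _, h⟩⟩

@[simp] theorem ends_copy : Ends (.copy x y) σ Q ↔ Q 1 (σ.setReg x (σ.reg y)) :=
  ⟨fun ⟨_, _, h, hq⟩ => by cases h; exact hq, fun h => ⟨_, _, .copy _ _ _, h⟩⟩

@[simp] theorem ends_succ : Ends (.succ x) σ Q ↔ Q 1 (σ.setReg x (σ.reg x + 1)) :=
  ⟨fun ⟨_, _, h, hq⟩ => by cases h; exact hq, fun h => ⟨_, _, .succ _ _, h⟩⟩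

@[simp] theorem ends_pred : Ends (.pred x) σ Q ↔ Q 1 (σ.setReg x (σ.reg x - 1)) :=
  ⟨fun ⟨_, _, h, hq⟩ => by cases h; exact hq, fun h => ⟨_, _, .pred _ _, h⟩⟩

@[simp] theorem ends_load :
    Ends (.load x a i j) σ Q ↔ Q 1 (σ.setReg x (σ.arr a (σ.reg i) (σ.reg j))) :=
  ⟨fun ⟨_, _, h, hq⟩ => by cases h; exact hq, fun h => ⟨_, _, .load _ _ _ _ _, h⟩⟩

@[simp] theorem ends_store :
    Ends (.store a i j x) σ Q ↔ Q 1 (σ.setArr a (σ.reg i) (σ.reg j) (σ.reg x)) :=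
  ⟨fun ⟨_, _, h, hq⟩ => by cases h; exact hq, fun h => ⟨_, _, .store _ _ _ _ _, h⟩⟩

@[simp] theorem ends_seq : Ends (.seq p q) σ Q ↔
    Ends p σ fun t₁ σ₁ => Ends q σ₁ fun t₂ σ₂ => Q (t₁ + t₂) σ₂ := by
  constructor
  · rintro ⟨_, _, h, hq⟩
    cases h with
    | seq h₁ h₂ => exact ⟨_, _, h₁, _, _, h₂, hq⟩
  · rintro ⟨_, _, h₁, _, _, h₂, hq⟩
    exact ⟨_, _, .seq h₁ h₂, hq⟩

@[simp] theorem ends_branch : Ends (.branch b p q) σ Q ↔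
    (b.Holds σ → Ends p σ fun t => Q (1 + t)) ∧ (¬b.Holds σ → Ends q σ fun t => Q (1 + t)) := by
  constructor
  · rintro ⟨_, _, h, hq⟩
    cases h with
    | branch_true hb h => exact ⟨fun _ => ⟨_, _, h, hq⟩, fun h => absurd hb h⟩
    | branch_false hb h => exact ⟨fun h => absurd h hb, fun _ => ⟨_, _, h, hq⟩⟩
  · rintro ⟨h₁, h₂⟩
    by_cases hb : b.Holds σ
    · obtain ⟨_, _, h, hq⟩ := h₁ hb
      exact ⟨_, _, .branch_true hb h, hq⟩
    · obtain ⟨_, _, h, hq⟩ := h₂ hb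
      exact ⟨_, _, .branch_false hb h, hq⟩

open Classical in
theorem ends_branch_eq_ite : Ends (.branch b p q) σ Q ↔
    if b.Holds σ then Ends p σ fun t => Q (1 + t) else Ends q σ fun t => Q (1 + t) := by
  by_cases hb : b.Holds σ <;> simp [hb]

/-- A loop with an invariant `I` that includes a budget for the remaining steps. -/
theorem Ends.loop {I : ℕ → RamState → Prop}
    (step : ∀ B σ, I B σ → b.Holds σ → Ends p σ fun t σ' => ∃ B', t + 1 + B' ≤ B ∧ I B' σ')
    {B : ℕ} (h : I B σ) :
    Ends (.loop b p) σ fun t σ' => ¬b.Holds σ' ∧ ∃ B', t + B' ≤ B + 1 ∧ I B' σ' := by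
  induction B using Nat.strong_induction_on generalizing σ with
  | _ B ih =>
    by_cases hb : b.Holds σ
    · obtain ⟨t₁, σ₁, h₁, B₁, hB₁, hI₁⟩ := step B σ h hb
      obtain ⟨t₂, σ₂, h₂, hb₂, B₂, hB₂, hI₂⟩ := ih B₁ (by omega) hI₁
      exact ⟨_, _, .loop_true hb h₁ h₂, hb₂, B₂, by omega, hI₂⟩
    · exact ⟨1, σ, .loop_false hb, hb, B, by omega, h⟩

/-- `for x = 0, …, y - 1 do p`. -/
def forLoop (x y : ℕ) (p : RamProgram) : RamProgram :=
  .seq (.const x 0) (.loop (.lt x y) (.seq p (.succ x)))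

/-- A `for` loop whose rounds take `c` steps each, up to a change of the potential, which is the
second argument of the invariant. -/
theorem Ends.forLoop_of_potential {I : ℕ → ℕ → RamState → Prop} {n c : ℕ} (hxy : x ≠ y)
    (step : ∀ i < n, ∀ P σ, I i P σ → σ.reg x = i → σ.reg y = n → Ends p σ fun t σ' =>
      σ'.reg x = i ∧ σ'.reg y = n ∧ ∃ P', t + P' ≤ c + P ∧ I (i + 1) P' (σ'.setReg x (i + 1)))
    (hy : σ.reg y = n) {P : ℕ} (h : I 0 P (σ.setReg x 0)) :
    Ends (forLoop x y p) σ fun t σ' => t ≤ (c + 2) * n + P + 2 ∧ ∃ P', I n P' σ' := by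
  -- A round costs c for the body, one step for the increment and one for the test. The final + 2 in
  -- the bound pays for the initialization and the failing test.
  have hloop := Ends.loop (b := .lt x y) (p := .seq p (.succ x)) (σ := σ.setReg x 0)
    (I := fun B σ => ∃ i P, i ≤ n ∧ σ.reg x = i ∧ σ.reg y = n ∧ B = (c + 2) * (n - i) + P ∧ I i P σ)
    (B := (c + 2) * n + P) (by
      rintro B σ ⟨i, P, hi, hx, hy, rfl, hI⟩ hb
      have hlt : i < n := by simpa [RamTest.Holds, hx, hy] using hb
      rw [ends_seq]
      refine (step i hlt P σ hI hx hy).mono ?_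
      rintro t σ' ⟨hx', hy', P', ht, hI'⟩
      rw [ends_succ, hx']
      refine ⟨_, ?_, i + 1, P', hlt, by simp, by simp [hy', hxy.symm], rfl, hI'⟩
      obtain ⟨d, rfl⟩ := Nat.exists_eq_add_of_lt hlt
      have h1 : i + d + 1 - (i + 1) = d := by omega
      have h2 : i + d + 1 - i = d + 1 := by omega
      rw [h1, h2, Nat.mul_succ]
      omega) ⟨0, P, Nat.zero_le n, by simp, by simp [hy, hxy.symm], by simp, h⟩
  rw [forLoop, ends_seq, ends_const]
  refine hloop.mono ?_
  rintro t σ' ⟨hb, B', ht, i, P', hi, hx, hy, rfl, hI⟩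
  have hin : i = n := by
    have : ¬i < n := by simpa [RamTest.Holds, hx, hy] using hb
    omega
  subst hin
  exact ⟨by omega, P', hI⟩

theorem Ends.forLoop {I : ℕ → RamState → Prop} {n c : ℕ} (hxy : x ≠ y)
    (step : ∀ i < n, ∀ σ, I i σ → σ.reg x = i → σ.reg y = n → Ends p σ fun t σ' =>
      σ'.reg x = i ∧ σ'.reg y = n ∧ t ≤ c ∧ I (i + 1) (σ'.setReg x (i + 1)))
    (hy : σ.reg y = n) (h : I 0 (σ.setReg x 0)) :
    Ends (forLoop x y p) σ fun t σ' => t ≤ (c + 2) * n + 2 ∧ I n σ' := by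
  refine (Ends.forLoop_of_potential (I := fun i P σ => P = 0 ∧ I i σ) (c := c) (P := 0) hxy ?_ hy
    ⟨rfl, h⟩).mono ?_
  · rintro i hi P σ ⟨rfl, hI⟩ hx hy
    refine (step i hi σ hI hx hy).mono ?_
    rintro t σ' ⟨h1, h2, h3, h4⟩
    exact ⟨h1, h2, 0, h3, rfl, h4⟩
  · rintro t σ' ⟨ht, P', -, hI⟩
    exact ⟨ht, hI⟩

end RamProgram

/-! ### Finding the top of a set and labelling the path to the root. -/

namespace OverlayProgram

open WeightedGraph Preprocessed RamProgram

variable {n k : ℕ} {G : WeightedGraph (Fin n)} {D : Preprocessed G} {S : Fin k → Finset (Fin n)}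

/-- The memory holds the input, the index `i` of the current set in register `3`, and the constants
`0` and `1` in the registers `4` and `5`. -/
structure Ctx (D : Preprocessed G) (S : Fin k → Finset (Fin n)) (i : ℕ) (σ : RamState) :
    Prop where
  reg_zero : σ.reg 0 = n
  reg_one : σ.reg 1 = k
  reg_two : σ.reg 2 = D.root
  reg_three : σ.reg 3 = i
  reg_four : σ.reg 4 = 0
  reg_five : σ.reg 5 = 1
  parent : ∀ v : Fin n, σ.arr 0 0 v = D.parent v
  opposite : ∀ x v : Fin n, σ.arr 1 x v = if v ∈ D.opposite x then 1 else 0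
  member : ∀ (j : Fin k) (v : Fin n), σ.arr 2 j v = if v ∈ S j then 1 else 0

variable {σ : RamState} {i : ℕ}

@[simp] theorem ctx_setReg {x m : ℕ} (hx : 6 ≤ x) :
    Ctx D S i (σ.setReg x m) ↔ Ctx D S i σ := by
  constructor <;> rintro ⟨h0, h1, h2, h3, h4, h5, h6, h7, h8⟩
  · rw [RamState.setReg_reg, if_neg (by omega)] at h0 h1 h2 h3 h4 h5
    exact ⟨h0, h1, h2, h3, h4, h5, h6, h7, h8⟩
  · constructor <;> (try rw [RamState.setReg_reg, if_neg (by omega)]) <;> assumption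

@[simp] theorem ctx_setArr {a r c m : ℕ} (ha : 3 ≤ a) :
    Ctx D S i (σ.setArr a r c m) ↔ Ctx D S i σ := by
  have h (b : ℕ) (hb : b < 3) : (σ.setArr a r c m).arr b = σ.arr b := by
    rw [RamState.setArr_arr, if_neg (by omega)]
  constructor <;> rintro ⟨h0, h1, h2, h3, h4, h5, h6, h7, h8⟩
  · rw [h _ (by omega)] at h6 h7 h8
    exact ⟨h0, h1, h2, h3, h4, h5, h6, h7, h8⟩
  · exact ⟨h0, h1, h2, h3, h4, h5, by rwa [h _ (by omega)], by rwa [h _ (by omega)],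
      by rwa [h _ (by omega)]⟩

/-- Clear row `0` of array `4`, and put the vertex of the current set that is closest to the root
into register `8`. -/
def findTop : RamProgram :=
  forLoop 6 0 <|
    .seq (.store 4 4 6 4) <|
    .seq (.load 7 2 3 6) <|
    .branch (.eq 7 5)
      (.branch (.eq 6 2)
        (.copy 8 6)
        (.seq (.load 9 0 4 6) <|
          .seq (.load 7 2 3 9) <|
          .branch (.eq 7 4) (.copy 8 6) .skip))
      .skip

theorem ends_findTop {j : Fin k} (hj : G.IsSC (S j)) (h : Ctx D S j σ) :
    Ends findTop σ fun t σ' => t ≤ 10 * n + 2 ∧ Ctx D S j σ' ∧ σ'.arr 3 = σ.arr 3 ∧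
      (∀ u : Fin n, σ'.arr 4 0 u = 0) ∧ ∃ a, D.IsTop (S j) a ∧ σ'.reg 8 = a := by
  refine (Ends.forLoop (n := n) (c := 8) (I := fun i σ' => Ctx D S j σ' ∧ σ'.arr 3 = σ.arr 3 ∧
    (∀ u : Fin n, u < i → σ'.arr 4 0 u = 0) ∧
    ((∃ a : Fin n, a < i ∧ D.IsTop (S j) a) → ∃ a, D.IsTop (S j) a ∧ σ'.reg 8 = a))
    (by decide) ?_ h.reg_zero ?_).mono ?_
  · rintro i hi σ ⟨hc, h3, h4, h8⟩ hx hy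
    obtain ⟨v, rfl⟩ : ∃ v : Fin n, i = v := ⟨⟨i, hi⟩, rfl⟩
    have h4' : ∀ u ≤ v, ¬u = v → σ.arr 4 0 u = 0 := fun u hu hne => h4 u (by omega)
    have h8' : ¬D.IsTop (S j) v → ∀ u ≤ v, D.IsTop (S j) u →
        ∃ a, D.IsTop (S j) a ∧ σ.reg 8 = a := fun hv u huv hu =>
      h8 ⟨u, lt_of_le_of_ne huv fun h => hv (Fin.ext h ▸ hu), hu⟩
    -- Symbolic execution of one round; one goal per outcome of the tests remains.
    simp [RamTest.Holds, hx, hy, hc, hc.reg_two, hc.reg_three, hc.reg_four, hc.reg_five,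
      hc.parent, hc.member, h3, Fin.val_inj]
    exact ⟨fun hv => ⟨fun hr => ⟨h4', fun _ _ _ => ⟨hv, fun h => absurd hr h⟩⟩,
      fun hr => ⟨fun hp => ⟨h4', fun _ _ _ => ⟨hv, fun _ => hp⟩⟩,
        fun hp => ⟨h4', h8' fun ht => ht.2 hr hp⟩⟩⟩, fun hv => ⟨h4', h8' fun ht => hv ht.1⟩⟩
  · simp [h]
  · rintro t σ' ⟨ht, hc, h3, h4, h8⟩
    obtain ⟨a, ha, -⟩ := D.exists_isTop hj
    exact ⟨ht, hc, h3, fun u => h4 u u.2, h8 ⟨a, a.2, ha⟩⟩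

section Path

variable {A : Finset (Fin n)} {a p u v x : Fin n}

/-- `x` lies on the path from `a` to the root, and the opposite SC of `x` is a cluster of `Ω(A)`. -/
def IsLabel (D : Preprocessed G) (A : Finset (Fin n)) (a x : Fin n) : Prop :=
  x ≠ D.root ∧ a ∈ D.subtree x ∧ G.IsMaxAway A (D.opposite x)

/-- `u` is a proper ancestor of `a`. -/
def IsAbove (D : Preprocessed G) (a u : Fin n) : Prop := a ∈ D.subtree u ∧ u ≠ a

/-- `m` tells which label the cluster of `u` has, if `u` lies on the path from `a` to the root. -/
def IsPathEntry (D : Preprocessed G) (A : Finset (Fin n)) (a u : Fin n) (m : ℕ) : Prop :=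
  ∃ x, IsLabel D A a x ∧ u ∈ D.opposite x ∧ m = x + 1

/-- The first alternative of the hypothesis is the start of the walk: a lies in A and has no label
yet, so a itself is the provisional label, justified as soon as a is known not to be the root. -/
theorem isLabel_step (ha : D.IsTop A a) (hA : G.IsSC A) (hp : p ≠ D.root)
    (hap : a ∈ D.subtree p)
    (hx : p = a ∧ x = a ∨ IsLabel D A a x ∧ p ∈ D.opposite x) :
    (D.parent p ∈ D.opposite x → IsLabel D A a x) ∧
      (D.parent p ∉ D.opposite x → IsLabel D A a p) := by
  rcases hx with ⟨rfl, rfl⟩ | ⟨hx, hpx⟩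
  · have := ha.isMaxAway_opposite hA hp
    exact ⟨fun _ => ⟨hp, hap, this⟩, fun _ => ⟨hp, hap, this⟩⟩
  · exact ⟨fun _ => hx, fun h =>
      ⟨hp, hap, ha.isMaxAway_opposite_of_parent_notMem hA hx.2.2 hpx hap hp h⟩⟩

theorem isAbove_step (hp : p ≠ D.root) (hap : a ∈ D.subtree p) :
    IsAbove D a u ∧ u ∈ D.subtree (D.parent p) ↔
      u = D.parent p ∨ IsAbove D a u ∧ u ∈ D.subtree p := by
  constructor
  · rintro ⟨hu, hup⟩
    rcases ParentTree.mem_subtree_total hap hu.1 with h | h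
    · by_cases hpu : p = u
      · exact Or.inr ⟨hu, hpu ▸ D.self_mem_subtree p⟩
      · exact Or.inl (D.subtree_antisymm hup (ParentTree.parent_mem_subtree h hpu))
    · exact Or.inr ⟨hu, h⟩
  · rintro (rfl | ⟨hu, hup⟩)
    · have h := D.mem_subtree_parent p
      exact ⟨⟨ParentTree.mem_subtree_trans hap h, fun h' =>
        D.parent_notMem_subtree hp (h' ▸ hap)⟩, D.self_mem_subtree _⟩
    · exact ⟨hu, ParentTree.mem_subtree_trans hup (D.mem_subtree_parent p)⟩

theorem card_subtree_lt (hp : p ≠ D.root) :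
    (D.subtree p).card < (D.subtree (D.parent p)).card :=
  Finset.card_lt_card ⟨fun _ hu => ParentTree.mem_subtree_trans hu (D.mem_subtree_parent p),
    fun h => D.parent_notMem_subtree hp (h (D.self_mem_subtree _))⟩

end Path

/-- One step of `walk`. -/
def walkStep : RamProgram :=
  .seq (.copy 13 11) <|
  .seq (.load 11 0 4 11) <|
  .seq (.load 7 1 10 11) <|
  .seq (.branch (.eq 7 5) .skip (.copy 10 13)) <|
  .seq (.copy 7 10) <|
  .seq (.succ 7) <|
  .seq (.store 4 4 11 7) <|
  .branch (.eq 11 2) (.const 12 1) .skip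

/-- Walk from the vertex in register `8` to the root, and write the labels of the clusters on the
way into row `0` of array `4`. -/
def walk : RamProgram :=
  .seq (.copy 10 8) <|
  .seq (.copy 11 8) <|
  .seq (.const 12 0) <|
  .seq (.branch (.eq 8 2) (.const 12 1) .skip) <|
  .loop (.eq 12 4) walkStep

/-- The invariant of the loop of `walk`. -/
structure WalkInv (D : Preprocessed G) (S : Fin k → Finset (Fin n)) (j : Fin k) (a : Fin n)
    (out : ℕ → ℕ → ℕ) (p x : Fin n) (σ : RamState) : Prop where
  ctx : Ctx D S j σ
  out_eq : σ.arr 3 = out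
  label : σ.reg 10 = x
  pos : σ.reg 11 = p
  flag : σ.reg 12 = if p = D.root then 1 else 0
  above : a ∈ D.subtree p
  isLabel : p = a ∧ x = a ∨ IsLabel D (S j) a x ∧ p ∈ D.opposite x
  entry : ∀ u : Fin n, (IsAbove D a u ∧ u ∈ D.subtree p → IsPathEntry D (S j) a u (σ.arr 4 0 u)) ∧
    (¬(IsAbove D a u ∧ u ∈ D.subtree p) → σ.arr 4 0 u = 0)

theorem WalkInv.next {j : Fin k} {a p x y : Fin n} {out : ℕ → ℕ → ℕ} {τ : RamState}
    (hI : WalkInv D S j a out p x σ) (hp : p ≠ D.root)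
    (hy : IsLabel D (S j) a y ∧ D.parent p ∈ D.opposite y) (ctx : Ctx D S j τ)
    (out_eq : τ.arr 3 = out) (label : τ.reg 10 = y) (pos : τ.reg 11 = D.parent p)
    (flag : τ.reg 12 = if D.parent p = D.root then 1 else 0)
    (entry : ∀ u : Fin n, τ.arr 4 0 u = if u = D.parent p then (y : ℕ) + 1 else σ.arr 4 0 u) :
    WalkInv D S j a out (D.parent p) y τ where
  ctx := ctx
  out_eq := out_eq
  label := label
  pos := pos
  flag := flag
  above := ParentTree.mem_subtree_trans hI.above (D.mem_subtree_parent p)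
  isLabel := Or.inr hy
  entry u := by
    rw [isAbove_step hp hI.above, entry u]
    by_cases hu : u = D.parent p
    · rw [if_pos hu, hu]
      exact ⟨fun _ => ⟨y, hy.1, hy.2, rfl⟩, fun h => absurd (Or.inl rfl) h⟩
    · rw [if_neg hu]
      simpa only [hu, false_or] using hI.entry u

theorem ends_walk {j : Fin k} (hj : G.IsSC (S j)) (h : Ctx D S j σ) {a : Fin n}
    (ha : D.IsTop (S j) a) (h8 : σ.reg 8 = a) (h4 : ∀ u : Fin n, σ.arr 4 0 u = 0) :
    Ends walk σ fun t σ' => t ≤ 11 * n + 6 ∧ Ctx D S j σ' ∧ σ'.arr 3 = σ.arr 3 ∧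
      ∀ u : Fin n, (IsAbove D a u → IsPathEntry D (S j) a u (σ'.arr 4 0 u)) ∧
        (¬IsAbove D a u → σ'.arr 4 0 u = 0) := by
  have hloop : ∀ σ', WalkInv D S j a (σ.arr 3) a a σ' →
      Ends (.loop (.eq 12 4) walkStep) σ' fun t σ' => ¬(RamTest.eq 12 4).Holds σ' ∧
        ∃ B', t + B' ≤ 11 * (n - (D.subtree a).card) + 1 ∧
          ∃ p x, B' = 11 * (n - (D.subtree p).card) ∧ WalkInv D S j a (σ.arr 3) p x σ' := by
    -- A pass takes ten steps and one test, and the subtree below the current vertex grows strictly.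
    refine fun σ' h' => Ends.loop (I := fun B σ' => ∃ p x, B = 11 * (n - (D.subtree p).card) ∧
      WalkInv D S j a (σ.arr 3) p x σ') ?_ ⟨a, a, rfl, h'⟩
    rintro B σ' ⟨p, x, rfl, hI⟩ hb
    have hpr : p ≠ D.root := by
      intro hpr
      simp [RamTest.Holds, hI.flag, hI.ctx.reg_four, hpr] at hb
    obtain ⟨hl1, hl2⟩ := isLabel_step ha hj hpr hI.above hI.isLabel
    have hcard := card_subtree_lt hpr
    have hcard' : (D.subtree (D.parent p)).card ≤ n := by
      simpa using (D.subtree (D.parent p)).card_le_univ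
    have hc := hI.ctx
    have hout := hI.out_eq
    have hflag : σ'.reg 12 = 0 := by rw [hI.flag, if_neg hpr]
    have hmem := (D.opposite_isSC p hpr).mem
    simp [walkStep, RamTest.Holds, hc.reg_two, hc.reg_four, hc.reg_five, hc.parent, hc.opposite,
      hI.label, hI.pos, Fin.val_inj]
    refine ⟨fun hm =>
      ⟨fun hr => ⟨D.parent p, by omega, x, hI.next hpr ⟨hl1 hm, hm⟩ ?_ ?_ ?_ ?_ ?_ ?_⟩,
      fun hr => ⟨D.parent p, by omega, x, hI.next hpr ⟨hl1 hm, hm⟩ ?_ ?_ ?_ ?_ ?_ ?_⟩⟩,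
      fun hm => ⟨fun hr => ⟨D.parent p, by omega, p, hI.next hpr ⟨hl2 hm, hmem⟩ ?_ ?_ ?_ ?_ ?_ ?_⟩,
      fun hr => ⟨D.parent p, by omega, p, hI.next hpr ⟨hl2 hm, hmem⟩ ?_ ?_ ?_ ?_ ?_ ?_⟩⟩⟩ <;>
      simp [hc, hout, hr, hI.label, hflag, Fin.val_inj]
  have hpost : ∀ t₀ ≤ 5, ∀ σ₀, WalkInv D S j a (σ.arr 3) a a σ₀ →
      Ends (.loop (.eq 12 4) walkStep) σ₀ fun t σ' => t₀ + t ≤ 11 * n + 6 ∧ Ctx D S j σ' ∧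
        σ'.arr 3 = σ.arr 3 ∧
        ∀ u : Fin n, (IsAbove D a u → IsPathEntry D (S j) a u (σ'.arr 4 0 u)) ∧
          (¬IsAbove D a u → σ'.arr 4 0 u = 0) := by
    refine fun t₀ ht₀ σ₀ h₀ => (hloop σ₀ h₀).mono ?_
    rintro t σ' ⟨hb, B', ht, p, x, rfl, hI⟩
    have hpr : p = D.root := by
      by_contra hpr
      simp [RamTest.Holds, hI.flag, hI.ctx.reg_four, hpr] at hb
    exact ⟨by omega, hI.ctx, hI.out_eq, fun u => by
      simpa [hpr, D.mem_subtree_root u] using hI.entry u⟩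
  have hinit : ∀ u : Fin n, ¬(IsAbove D a u ∧ u ∈ D.subtree a) := fun u hu =>
    hu.1.2 (D.subtree_antisymm hu.2 hu.1.1)
  simp only [walk, ends_seq, ends_copy, ends_const, ends_branch, ends_skip]
  constructor
  · intro hr
    simp only [← add_assoc]
    refine hpost 5 le_rfl _ ?_
    have hr' : a = D.root := by
      simpa [RamTest.Holds, h8, h.reg_two, Fin.val_inj] using hr
    exact ⟨by simpa using h, by simp, by simp [h8], by simp [h8], by simp [hr'],
      D.self_mem_subtree a, Or.inl ⟨rfl, rfl⟩, fun u => ⟨fun hu => absurd hu (hinit u),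
      fun _ => by simpa using h4 u⟩⟩
  · intro hr
    simp only [← add_assoc]
    refine hpost 5 le_rfl _ ?_
    have hr' : a ≠ D.root := by
      simpa [RamTest.Holds, h8, h.reg_two, Fin.val_inj] using hr
    exact ⟨by simpa using h, by simp, by simp [h8], by simp [h8], by simp [hr'],
      D.self_mem_subtree a, Or.inl ⟨rfl, rfl⟩, fun u => ⟨fun hu => absurd hu (hinit u),
      fun _ => by simpa using h4 u⟩⟩

end OverlayProgram

/-! ### Colors of the clusters. -/

namespace OverlayProgram

open WeightedGraph Preprocessed RamProgram

variable {n k : ℕ} {G : WeightedGraph (Fin n)} {D : Preprocessed G} {S : Fin k → Finset (Fin n)}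
variable {σ : RamState}

section Color

variable {A C C' : Finset (Fin n)} {a u v : Fin n} {m m' : ℕ}

/-- `m` is the color of the cluster `C` of `Ω(A)`. -/
def IsCode (D : Preprocessed G) (A : Finset (Fin n)) (a : Fin n) (m : ℕ) (C : Finset (Fin n)) :
    Prop :=
  (C = A ∧ m = n + 1) ∨ (∃ x, IsLabel D A a x ∧ C = D.opposite x ∧ m = x + 1) ∨
    ∃ c, a ∉ D.subtree c ∧ G.IsMaxAway A (D.subtree c) ∧ C = D.subtree c ∧ m = c + 1

/-- `m` is the color of the cluster of `v`. -/
def IsColor (D : Preprocessed G) (A : Finset (Fin n)) (a v : Fin n) (m : ℕ) : Prop :=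
  ∃ C, v ∈ C ∧ IsCode D A a m C

theorem IsCode.eq_or_isMaxAway (h : IsCode D A a m C) : C = A ∨ G.IsMaxAway A C := by
  rcases h with ⟨rfl, -⟩ | ⟨x, hx, rfl, -⟩ | ⟨c, -, hc, rfl, -⟩
  · exact Or.inl rfl
  · exact Or.inr hx.2.2
  · exact Or.inr hc

theorem IsColor.ne_zero (h : IsColor D A a v m) : m ≠ 0 := by
  rcases h with ⟨C, -, ⟨-, rfl⟩ | ⟨x, -, -, rfl⟩ | ⟨c, -, -, -, rfl⟩⟩ <;> omega

theorem ne_of_isMaxAway (ha : a ∈ A) (h : G.IsMaxAway A C) : A ≠ C := by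
  rintro rfl
  exact Finset.disjoint_left.1 h.2.1 ha ha

/-- Opposite SCs are coded by vertices on the path and subtrees by vertices off it, so the two kinds
cannot clash, and n + 1 exceeds all their codes. The shift by one reserves 0 for "no color". -/
theorem IsCode.eq_iff (ha : a ∈ A) (h : IsCode D A a m C) (h' : IsCode D A a m' C') :
    m = m' ↔ C = C' := by
  rcases h with ⟨rfl, rfl⟩ | ⟨x, hx, rfl, rfl⟩ | ⟨c, hac, hc, rfl, rfl⟩ <;>
    rcases h' with ⟨rfl, rfl⟩ | ⟨y, hy, rfl, rfl⟩ | ⟨d, had, hd, rfl, rfl⟩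
  · simp
  · exact iff_of_false (by omega) (ne_of_isMaxAway ha hy.2.2)
  · exact iff_of_false (by omega) (ne_of_isMaxAway ha hd)
  · exact iff_of_false (by omega) (ne_of_isMaxAway ha hx.2.2).symm
  · refine ⟨fun h => ?_, fun h => by rw [eq_of_opposite_eq hx.1 hy.1 hx.2.1 hy.2.1 h]⟩
    rw [Fin.ext (Nat.succ_injective h)]
  · refine iff_of_false (fun h => had ?_) (subtree_ne_opposite hx.1).symm
    exact (Fin.ext (Nat.succ_injective h) : x = d) ▸ hx.2.1
  · exact iff_of_false (by omega) (ne_of_isMaxAway ha hc).symm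
  · refine iff_of_false (fun h => hac ?_) (subtree_ne_opposite hy.1)
    exact (Fin.ext (Nat.succ_injective h) : c = y) ▸ hy.2.1
  · refine ⟨fun h => by rw [Fin.ext (Nat.succ_injective h)], fun h => ?_⟩
    have h1 := D.self_mem_subtree c
    have h2 := D.self_mem_subtree d
    rw [h] at h1
    rw [← h] at h2
    rw [D.subtree_antisymm h1 h2]

theorem IsColor.eq_iff (ha : a ∈ A) (h : IsColor D A a u m) (h' : IsColor D A a v m') :
    m = m' ↔ ∃ C, (C = A ∨ G.IsMaxAway A C) ∧ u ∈ C ∧ v ∈ C := by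
  obtain ⟨C, hu, hC⟩ := h
  obtain ⟨C', hv, hC'⟩ := h'
  have key : ∀ E E' w, (E = A ∨ G.IsMaxAway A E) → (E' = A ∨ G.IsMaxAway A E') → w ∈ E → w ∈ E' →
      E = E' := by
    rintro E E' w (rfl | hE) (rfl | hE') hw hw'
    · rfl
    · exact absurd hw (Finset.disjoint_left.1 hE'.2.1 hw')
    · exact absurd hw' (Finset.disjoint_left.1 hE.2.1 hw)
    · exact hE.eq hE' hw hw'
  rw [hC.eq_iff ha hC']
  constructor
  · rintro rfl
    exact ⟨C, hC.eq_or_isMaxAway, hu, hv⟩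
  · rintro ⟨E, hE, huE, hvE⟩
    rw [key C E u hC.eq_or_isMaxAway hE hu huE, key C' E v hC'.eq_or_isMaxAway hE hv hvE]

/-- Neither `v` nor its parent lies in `A` or on the path from `a` to the root. -/
def IsOff (D : Preprocessed G) (A : Finset (Fin n)) (a v : Fin n) : Prop :=
  a ∉ D.subtree v ∧ D.parent v ∉ A ∧ a ∉ D.subtree (D.parent v)

theorem IsOff.isColor (hv : IsOff D A a v) (ha : D.IsTop A a) (hA : G.IsSC A)
    (h : IsColor D A a (D.parent v) m) : IsColor D A a v m := by
  obtain ⟨C, hu, hC⟩ := h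
  refine ⟨C, ?_, hC⟩
  rcases hC.eq_or_isMaxAway with rfl | hmax
  · exact absurd hu hv.2.1
  · exact ha.subtree_subset hA hv.2.1 hv.2.2 hmax hu (D.mem_subtree_parent v)

/-- `m` is the color of the cluster of `v`, or `0`, in which case this cluster is that of the
parent of `v`. -/
def IsEntry (D : Preprocessed G) (A : Finset (Fin n)) (a v : Fin n) (m : ℕ) : Prop :=
  m = 0 ∧ IsOff D A a v ∨ IsColor D A a v m

theorem IsPathEntry.isColor (h : IsPathEntry D A a v m) : IsColor D A a v m := by
  obtain ⟨x, hx, hv, rfl⟩ := h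
  exact ⟨_, hv, Or.inr (Or.inl ⟨x, hx, rfl, rfl⟩)⟩

theorem isColor_subtree (hav : a ∉ D.subtree v) (h : G.IsMaxAway A (D.subtree v)) :
    IsColor D A a v (v + 1) :=
  ⟨_, D.self_mem_subtree v, Or.inr (Or.inr ⟨v, hav, h, rfl, rfl⟩)⟩

end Color

/-- One round of `assign`. -/
def assignStep : RamProgram :=
  .seq (.load 7 2 3 6) <|
  .seq (.branch (.eq 7 5)
    (.seq (.copy 14 0) (.succ 14))
    (.seq (.load 14 4 4 6) <|
      .branch (.eq 14 4)
        (.seq (.load 9 0 4 6) <|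
          .seq (.load 7 2 3 9) <|
          .branch (.eq 7 5)
            (.seq (.copy 14 6) (.succ 14))
            (.seq (.load 14 4 4 9) <|
              .branch (.eq 14 4)
                .skip
                (.seq (.copy 10 14) <|
                  .seq (.pred 10) <|
                  .seq (.load 7 1 10 6) <|
                  .branch (.eq 7 5) .skip (.seq (.copy 14 6) (.succ 14)))))
        .skip))
  (.store 5 4 6 14)

/-- Write the colors of the clusters into row `0` of array `5`, except for vertices in the same
cluster as their parent. -/
def assign : RamProgram := forLoop 6 0 assignStep

theorem ends_assign {j : Fin k} (hj : G.IsSC (S j)) (h : Ctx D S j σ) {a : Fin n}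
    (ha : D.IsTop (S j) a)
    (h4 : ∀ u : Fin n, (IsAbove D a u → IsPathEntry D (S j) a u (σ.arr 4 0 u)) ∧
      (¬IsAbove D a u → σ.arr 4 0 u = 0)) :
    Ends assign σ fun t σ' => t ≤ 20 * n + 2 ∧ Ctx D S j σ' ∧ σ'.arr 3 = σ.arr 3 ∧
      ∀ u : Fin n, IsEntry D (S j) a u (σ'.arr 5 0 u) := by
  refine (Ends.forLoop (n := n) (c := 18) (I := fun i σ' => Ctx D S j σ' ∧ σ'.arr 3 = σ.arr 3 ∧
    σ'.arr 4 = σ.arr 4 ∧ ∀ u : Fin n, u < i → IsEntry D (S j) a u (σ'.arr 5 0 u))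
    (by decide) ?_ h.reg_zero ?_).mono ?_
  · rintro i hi τ ⟨hc, hτ3, hτ4, h5⟩ hx hy
    obtain ⟨v, rfl⟩ : ∃ v : Fin n, i = v := ⟨⟨i, hi⟩, rfl⟩
    have hrest : ∀ m, IsEntry D (S j) a v m → ∀ u ≤ v,
        IsEntry D (S j) a u (if u = v then m else τ.arr 5 0 u) := by
      intro m hm u hu
      split_ifs with huv
      · rwa [huv]
      · exact h5 u (by omega)
    have hpath : ∀ u : Fin n, u ∉ S j → σ.arr 4 0 u = 0 → a ∉ D.subtree u := by
      intro u hu h0 hau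
      obtain ⟨x, -, -, hx⟩ := (h4 u).1 ⟨hau, fun h => hu (h ▸ ha.1)⟩
      omega
    have hpath' : ∀ u : Fin n, σ.arr 4 0 u ≠ 0 → IsPathEntry D (S j) a u (σ.arr 4 0 u) := by
      intro u h0
      by_contra hu
      exact h0 ((h4 u).2 fun h => hu ((h4 u).1 h))
    by_cases hv : v ∈ S j
    -- With the `↓` lemmas each test is decided before its branches are visited, so only the branch
    -- taken is executed.
    · simp [assignStep, ↓ends_seq, ↓ends_branch_eq_ite, ↓ends_load, RamTest.Holds, hx, hc,
        hc.reg_zero, hc.reg_three, hc.reg_four, hc.reg_five, hc.member, hv, hτ3, hτ4, Fin.val_inj]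
      exact hrest _ (Or.inr ⟨S j, hv, Or.inl ⟨rfl, rfl⟩⟩)
    by_cases hv4 : σ.arr 4 0 v = 0
    swap
    · simp [assignStep, ↓ends_seq, ↓ends_branch_eq_ite, ↓ends_load, RamTest.Holds, hx, hc,
        hc.reg_zero, hc.reg_three, hc.reg_four, hc.reg_five, hc.member, hv, hτ3, hτ4, hv4,
        Fin.val_inj]
      exact hrest _ (Or.inr (hpath' v hv4).isColor)
    have hav := hpath v hv hv4
    have hvr := ne_root_of_notMem_subtree hav
    by_cases hu : D.parent v ∈ S j
    · simp [assignStep, ↓ends_seq, ↓ends_branch_eq_ite, ↓ends_load, RamTest.Holds, hx, hc,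
        hc.reg_zero, hc.reg_three, hc.reg_four, hc.reg_five, hc.member, hc.parent, hv, hτ3, hτ4,
        hv4, hu, Fin.val_inj]
      exact hrest _ (Or.inr (isColor_subtree hav (isMaxAway_subtree_of_parent_mem hj hvr hv hu)))
    by_cases hu4 : σ.arr 4 0 (D.parent v) = 0
    · simp [assignStep, ↓ends_seq, ↓ends_branch_eq_ite, ↓ends_load, RamTest.Holds, hx, hc,
        hc.reg_zero, hc.reg_three, hc.reg_four, hc.reg_five, hc.member, hc.parent, hv, hτ3, hτ4,
        hv4, hu, hu4, Fin.val_inj]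
      exact hrest _ (Or.inl ⟨rfl, hav, hu, hpath _ hu hu4⟩)
    obtain ⟨x, hxl, hux, hxe⟩ := hpath' _ hu4
    by_cases hvx : v ∈ D.opposite x
    · simp [assignStep, ↓ends_seq, ↓ends_branch_eq_ite, ↓ends_load, RamTest.Holds, hx, hc,
        hc.reg_zero, hc.reg_three, hc.reg_four, hc.reg_five, hc.member, hc.parent, hc.opposite, hv,
        hτ3, hτ4, hv4, hu, hxe, hvx, Fin.val_inj]
      exact hrest _ (Or.inr (IsPathEntry.isColor ⟨x, hxl, hvx, rfl⟩))
    · simp [assignStep, ↓ends_seq, ↓ends_branch_eq_ite, ↓ends_load, RamTest.Holds, hx, hc,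
        hc.reg_zero, hc.reg_three, hc.reg_four, hc.reg_five, hc.member, hc.parent, hc.opposite, hv,
        hτ3, hτ4, hv4, hu, hxe, hvx, Fin.val_inj]
      exact hrest _ (Or.inr (isColor_subtree hav
        (ha.isMaxAway_subtree_of_notMem hj hxl.2.2 hux hvx hv hav)))
  · simp [h]
  · rintro t σ' ⟨ht, hc, h3, -, h5⟩
    exact ⟨ht, hc, h3, fun u => h5 u u.2⟩

end OverlayProgram

/-! ### Passing colors down the tree in amortized linear time. -/

namespace OverlayProgram

open WeightedGraph Preprocessed RamProgram

variable {n k : ℕ} {G : WeightedGraph (Fin n)} {D : Preprocessed G} {S : Fin k → Finset (Fin n)}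
variable {σ : RamState}

/-- Climb from the vertex in register `9` to the first colored vertex, and load its color into
register `7`. -/
def climbUp : RamProgram :=
  .loop (.eq 7 4) (.seq (.load 9 0 4 9) (.load 7 5 4 9))

/-- Climb from the vertex in register `11` to the first colored vertex, and assign the color in
register `7` to the vertices on the way. -/
def paint : RamProgram :=
  .loop (.eq 14 4) (.seq (.store 5 4 11 7) (.seq (.load 11 0 4 11) (.load 14 5 4 11)))

/-- Color all vertices. -/
def colorAll : RamProgram :=
  forLoop 6 0 <|
    .seq (.copy 9 6) <|
    .seq (.load 7 5 4 9) <|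
    .seq climbUp <|
    .seq (.copy 11 6) <|
    .seq (.load 14 5 4 11) paint

theorem ends_climbUp {v : Fin n} {i l : ℕ} (h : Ctx D S i σ) {f : Fin n → ℕ}
    (hf : ∀ u : Fin n, σ.arr 5 0 u = f u) (h6 : σ.reg 6 = v) (h9 : σ.reg 9 = v)
    (h7 : σ.reg 7 = f v) (hl : f (D.parent^[l] v) ≠ 0) (hlt : ∀ i < l, f (D.parent^[i] v) = 0) :
    Ends climbUp σ fun t σ' => t ≤ 3 * l + 1 ∧ Ctx D S i σ' ∧ σ'.arr 3 = σ.arr 3 ∧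
      (∀ u : Fin n, σ'.arr 5 0 u = f u) ∧ σ'.reg 6 = v ∧ σ'.reg 7 = f (D.parent^[l] v) := by
  refine (Ends.loop (I := fun B τ => ∃ d ≤ l, B = 3 * (l - d) ∧ Ctx D S i τ ∧ τ.arr 3 = σ.arr 3 ∧
    (∀ u : Fin n, τ.arr 5 0 u = f u) ∧ τ.reg 6 = v ∧ τ.reg 9 = D.parent^[d] v ∧
    τ.reg 7 = f (D.parent^[d] v)) (B := 3 * l) ?_
    ⟨0, Nat.zero_le l, rfl, h, rfl, hf, h6, h9, h7⟩).mono ?_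
  · rintro B τ ⟨d, hd, rfl, hc, ho, hτ, h6', h9', h7'⟩ hb
    have hdl : d < l := by
      refine lt_of_le_of_ne hd ?_
      rintro rfl
      simp [RamTest.Holds, h7', hc.reg_four] at hb
      exact hl hb
    have hB : 2 + 1 + 3 * (l - (d + 1)) ≤ 3 * (l - d) := by omega
    simp only [ends_seq, ends_load]
    exact ⟨_, hB, d + 1, hdl, rfl, by simpa using hc, by simpa using ho, by simpa using hτ,
      by simpa using h6', by simp [Function.iterate_succ_apply', h9', hc.reg_four, hc.parent],
      by simp [Function.iterate_succ_apply', h9', hc.reg_four, hc.parent, hτ]⟩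
  · rintro t τ ⟨hb, B', ht, d, hd, rfl, hc, ho, hτ, h6', h9', h7'⟩
    have hdl : d = l := by
      by_contra hne
      have := hlt d (by omega)
      simp [RamTest.Holds, h7', hc.reg_four, this] at hb
    subst hdl
    exact ⟨by omega, hc, ho, hτ, h6', h7'⟩

/-- The number of vertices without a color. -/
def numUncolored (n : ℕ) (σ : RamState) : ℕ :=
  (Finset.univ.filter fun u : Fin n => σ.arr 5 0 u = 0).card

theorem ends_paint {j : Fin k} (hj : G.IsSC (S j)) {a v : Fin n} {l : ℕ} (ha : D.IsTop (S j) a)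
    (h : Ctx D S j σ) {f : Fin n → ℕ} (hf : ∀ u : Fin n, σ.arr 5 0 u = f u)
    (hentry : ∀ u, IsEntry D (S j) a u (f u))
    (h6 : σ.reg 6 = v) (h11 : σ.reg 11 = v) (h14 : σ.reg 14 = f v)
    (hl : f (D.parent^[l] v) ≠ 0) (hlt : ∀ i < l, f (D.parent^[i] v) = 0)
    (h7 : σ.reg 7 = f (D.parent^[l] v)) :
    Ends paint σ fun t σ' => t ≤ 4 * l + 1 ∧ Ctx D S j σ' ∧ σ'.arr 3 = σ.arr 3 ∧
      σ'.reg 6 = v ∧ (∀ u : Fin n, IsEntry D (S j) a u (σ'.arr 5 0 u)) ∧ σ'.arr 5 0 v ≠ 0 ∧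
      (∀ u, f u ≠ 0 → σ'.arr 5 0 u ≠ 0) ∧ numUncolored n σ' + l ≤ numUncolored n σ := by
  -- Downward along the path: an entry 0 means that the vertex shares the cluster of its parent.
  have hcolor : ∀ d ≤ l, IsColor D (S j) a (D.parent^[d] v) (f (D.parent^[l] v)) := by
    intro d hd
    induction hd using Nat.decreasingInduction with
    | self => exact (hentry _).resolve_left fun h0 => hl h0.1
    | of_succ d hd ih =>
      rcases hentry (D.parent^[d] v) with h0 | h0
      · rw [Function.iterate_succ_apply'] at ih
        exact h0.2.isColor ha hj ih
      · exact absurd (hlt d hd) h0.ne_zero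
  refine (Ends.loop (I := fun B τ => ∃ d ≤ l, B = 4 * (l - d) ∧ Ctx D S j τ ∧ τ.arr 3 = σ.arr 3 ∧
    τ.reg 6 = v ∧ τ.reg 11 = D.parent^[d] v ∧ τ.reg 7 = f (D.parent^[l] v) ∧
    τ.reg 14 = f (D.parent^[d] v) ∧ (∀ u : Fin n, IsEntry D (S j) a u (τ.arr 5 0 u)) ∧
    (d = 0 ∨ τ.arr 5 0 v ≠ 0) ∧ (∀ u, f u ≠ 0 → τ.arr 5 0 u ≠ 0) ∧
    (∀ u : Fin n, D.parent^[d] v ∈ D.subtree u → τ.arr 5 0 u = f u) ∧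
    numUncolored n τ + d ≤ numUncolored n σ) (B := 4 * l) ?_
    ⟨0, Nat.zero_le l, rfl, h, rfl, h6, h11, h7, h14, fun u => (hf u).symm ▸ hentry u, Or.inl rfl,
      fun u hu => (hf u).symm ▸ hu, fun u _ => hf u, le_rfl⟩).mono ?_
  · rintro B τ ⟨d, hd, rfl, hc, ho, h6', h11', h7', h14', hent, hv, hne, hsub, hnum⟩ hb
    have hdl : d < l := by
      refine lt_of_le_of_ne hd ?_
      rintro rfl
      simp [RamTest.Holds, h14', hc.reg_four] at hb
      exact hl hb
    have hB : 3 + 1 + 4 * (l - (d + 1)) ≤ 4 * (l - d) := by omega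
    have hcol := hcolor d hd
    have hroot : D.parent^[d] v ≠ D.root := by
      rcases hentry (D.parent^[d] v) with h0 | h0
      · exact ne_root_of_notMem_subtree h0.2.1
      · exact absurd (hlt d hdl) h0.ne_zero
    have hzero : τ.arr 5 0 (D.parent^[d] v) = 0 := by
      rw [hsub _ (D.self_mem_subtree _), hlt d hdl]
    have hpar : D.parent (D.parent^[d] v) ≠ D.parent^[d] v := fun h0 =>
      D.parent_notMem_subtree hroot (h0.symm ▸ D.self_mem_subtree _)
    generalize hw : D.parent^[d] v = w at *
    have hnum' : numUncolored n (τ.setArr 5 0 w (f (D.parent^[l] v))) < numUncolored n τ := by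
      refine Finset.card_lt_card (Finset.ssubset_iff_subset_ne.2 ⟨fun u hu => ?_, fun he => ?_⟩)
      · simp only [RamState.setArr_arr, if_true, true_and, Finset.mem_filter, Finset.mem_univ,
          Fin.val_inj] at hu ⊢
        split_ifs at hu with huw
        · rw [huw, hzero]
        · exact hu
      · have : w ∈ Finset.univ.filter fun u : Fin n => τ.arr 5 0 u = 0 := by simp [hzero]
        rw [← he] at this
        simp [hl] at this
    simp only [ends_seq, ends_store, ends_load, RamState.setReg_reg, RamState.setReg_arr,
      RamState.setArr_reg, hc.reg_four, h11', h7']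
    refine ⟨_, hB, d + 1, hdl, rfl, by simpa using hc, by simpa using ho, by simpa using h6', ?_,
      by simp, ?_, ?_, Or.inr ?_, ?_, ?_, ?_⟩
    · simp [Function.iterate_succ_apply', hw, hc.parent]
    · have := hsub (D.parent w) (D.mem_subtree_parent w)
      simpa [Function.iterate_succ_apply', hw, hc.parent, hc.reg_four, Fin.val_inj, hpar] using this
    · intro u
      by_cases huw : u = w
      · subst huw
        simp only [RamState.setArr_arr, if_true, and_self]
        exact Or.inr hcol
      · simpa [Fin.val_inj, huw] using hent u
    · by_cases hvw : v = w
      · simpa [hvw] using hl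
      · rcases hv with rfl | hv
        · exact absurd hw hvw
        · simpa [Fin.val_inj, hvw] using hv
    · intro u hu
      by_cases huw : u = w
      · simpa [huw] using hl
      · simpa [Fin.val_inj, huw] using hne u hu
    · intro u hu
      rw [Function.iterate_succ_apply', hw] at hu
      have huw : u ≠ w := by
        rintro rfl
        exact D.parent_notMem_subtree hroot hu
      simpa [Fin.val_inj, huw] using hsub u (ParentTree.mem_subtree_of_parent hu)
    · change numUncolored n (τ.setArr 5 0 w (f (D.parent^[l] v))) + (d + 1) ≤ _
      omega
  · rintro t τ ⟨hb, B', ht, d, hd, rfl, hc, ho, h6', h11', h7', h14', hent, hv, hne, hsub, hnum⟩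
    have hdl : d = l := by
      by_contra hdne
      have := hlt d (by omega)
      simp [RamTest.Holds, h14', hc.reg_four, this] at hb
    subst hdl
    refine ⟨by omega, hc, ho, h6', hent, ?_, hne, hnum⟩
    rcases hv with rfl | hv
    · exact hne _ hl
    · exact hv

theorem ends_colorAll {j : Fin k} (hj : G.IsSC (S j)) (h : Ctx D S j σ) {a : Fin n}
    (ha : D.IsTop (S j) a) (h5 : ∀ u : Fin n, IsEntry D (S j) a u (σ.arr 5 0 u)) :
    Ends colorAll σ fun t σ' => t ≤ 15 * n + 2 ∧ Ctx D S j σ' ∧ σ'.arr 3 = σ.arr 3 ∧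
      ∀ u : Fin n, IsColor D (S j) a u (σ'.arr 5 0 u) := by
  have hnum : numUncolored n σ ≤ n := by
    simpa only [numUncolored, Fintype.card_fin] using
      Finset.card_le_univ (Finset.univ.filter fun u : Fin n => σ.arr 5 0 u = 0)
  -- Each edge climbed costs three steps in `climbUp` and four in `paint`, and one vertex is colored
  -- for it; this is the potential. The remaining six steps are four loads and copies and two final
  -- tests.
  refine (Ends.forLoop_of_potential (n := n) (c := 6) (P := 7 * numUncolored n σ)
    (I := fun i P τ => P = 7 * numUncolored n τ ∧ Ctx D S j τ ∧ τ.arr 3 = σ.arr 3 ∧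
      (∀ u : Fin n, IsEntry D (S j) a u (τ.arr 5 0 u)) ∧ ∀ u : Fin n, u < i → τ.arr 5 0 u ≠ 0)
    (by decide) ?_ h.reg_zero ⟨rfl, by simpa using h, by simp, by simpa using h5, by simp⟩).mono ?_
  · rintro i hi P τ ⟨rfl, hc, ho, hent, hne⟩ hx hy
    obtain ⟨v, rfl⟩ : ∃ v : Fin n, i = v := ⟨⟨i, hi⟩, rfl⟩
    -- The climb stops at the root at the latest: the root lies on the path above S, hence always
    -- has a color.
    have hex : ∃ l, τ.arr 5 0 (D.parent^[l] v) ≠ 0 := by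
      obtain ⟨l, hl⟩ := D.reaches_root v
      refine ⟨l, fun h0 => ?_⟩
      rw [hl] at h0
      rcases hent D.root with h1 | h1
      · exact ne_root_of_notMem_subtree h1.2.1 rfl
      · exact h1.ne_zero h0
    classical
    obtain ⟨l, hl, hlt⟩ : ∃ l, τ.arr 5 0 (D.parent^[l] v) ≠ 0 ∧
        ∀ i < l, τ.arr 5 0 (D.parent^[i] v) = 0 :=
      ⟨Nat.find hex, Nat.find_spec hex, fun i hi => not_not.1 (Nat.find_min hex hi)⟩
    simp only [ends_seq, ends_copy, ends_load, RamState.setReg_reg, RamState.setReg_arr]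
    refine (ends_climbUp (D := D) (S := S) (i := j) (v := v) (l := l)
      (f := fun u => τ.arr 5 0 u) (by simpa using hc) (by simp) (by simpa using hx)
      (by simpa using hx) (by simp [hx, hc.reg_four]) hl hlt).mono ?_
    rintro t₁ σ₁ ⟨ht₁, hc₁, ho₁, hf₁, h6₁, h7₁⟩
    have hnum₁ : numUncolored n σ₁ = numUncolored n τ := by
      simp only [numUncolored, hf₁]
    refine (ends_paint hj (v := v) (l := l) (f := fun u => τ.arr 5 0 u) ha (by simpa using hc₁)
      (by simpa using hf₁) hent (by simpa using h6₁) (by simpa using h6₁)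
      (by simp [h6₁, hc₁.reg_four, hf₁]) hl hlt (by simpa using h7₁)).mono ?_
    rintro t₂ σ₂ ⟨ht₂, hc₂, ho₂, h6₂, hent₂, hv₂, hne₂, hnum₂⟩
    have hnum₂' : numUncolored n σ₂ + l ≤ numUncolored n σ₁ := hnum₂
    refine ⟨h6₂, hc₂.reg_zero, 7 * numUncolored n σ₂, by omega, rfl, by simpa using hc₂, ?_,
      by simpa using hent₂, ?_⟩
    · have h1 : σ₂.arr 3 = σ₁.arr 3 := ho₂
      have h2 : σ₁.arr 3 = τ.arr 3 := ho₁
      rw [h1, h2, ho]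
    · intro u hu
      by_cases huv : u = v
      · rwa [huv]
      · exact hne₂ u (hne u (by omega))
  · rintro t τ ⟨ht, P', -, hc, ho, hent, hne⟩
    exact ⟨by omega, hc, ho, fun u => (hent u).resolve_left fun h0 => hne u u.2 h0.1⟩

end OverlayProgram

/-! ### Common refinement by a table of color pairs, and the whole program. -/

namespace OverlayProgram

open WeightedGraph Preprocessed RamProgram

variable {n k : ℕ} {G : WeightedGraph (Fin n)} {D : Preprocessed G} {S : Fin k → Finset (Fin n)}
variable {σ : RamState} {i : ℕ}

/-- For every pair of an old and a new color, store a vertex with these colors. -/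
def fillTable : RamProgram :=
  forLoop 6 0 (.seq (.load 7 3 4 6) (.seq (.load 14 5 4 6) (.store 6 7 14 6)))

/-- Replace the old color of a vertex by the vertex stored for its old and its new color. -/
def readTable : RamProgram :=
  forLoop 6 0
    (.seq (.load 7 3 4 6) (.seq (.load 14 5 4 6) (.seq (.load 9 6 7 14) (.store 3 4 6 9))))

/-- The table is never cleared, which would be too expensive. Entries from earlier rounds do no
harm, since every pair that occurs now is overwritten before it is read. -/
theorem ends_fillTable (h : Ctx D S i σ) :
    Ends fillTable σ fun t σ' => t ≤ 5 * n + 2 ∧ Ctx D S i σ' ∧ σ'.arr 3 = σ.arr 3 ∧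
      σ'.arr 5 = σ.arr 5 ∧ ∀ u : Fin n, ∃ w : Fin n,
        σ'.arr 6 (σ.arr 3 0 u) (σ.arr 5 0 u) = w ∧ σ.arr 3 0 w = σ.arr 3 0 u ∧
          σ.arr 5 0 w = σ.arr 5 0 u := by
  refine (Ends.forLoop (n := n) (c := 3) (I := fun i' τ => Ctx D S i τ ∧ τ.arr 3 = σ.arr 3 ∧
    τ.arr 5 = σ.arr 5 ∧ ∀ u : Fin n, u < i' → ∃ w : Fin n,
      τ.arr 6 (σ.arr 3 0 u) (σ.arr 5 0 u) = w ∧ σ.arr 3 0 w = σ.arr 3 0 u ∧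
        σ.arr 5 0 w = σ.arr 5 0 u) (by decide) ?_ h.reg_zero (by simpa using h)).mono ?_
  · rintro i' hi τ ⟨hc, h3, h5, h6⟩ hx hy
    obtain ⟨v, rfl⟩ : ∃ v : Fin n, i' = v := ⟨⟨i', hi⟩, rfl⟩
    simp only [ends_seq, ends_load, ends_store]
    refine ⟨by simpa using hx, by simpa using hy, by simp, by simpa using hc, by simpa using h3,
      by simpa using h5, fun u hu => ?_⟩
    simp only [RamState.setReg_arr, RamState.setArr_arr, RamState.setReg_reg, if_true, h3, h5, hx,
      hc.reg_four, Nat.reduceEqDiff, if_false]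
    split_ifs with huv
    · exact ⟨v, rfl, huv.1.symm, huv.2.symm⟩
    · refine h6 u (lt_of_le_of_ne (Nat.lt_succ_iff.1 hu) fun he => huv ?_)
      rw [he]
      exact ⟨rfl, rfl⟩
  · rintro t τ ⟨ht, hc, h3, h5, h6⟩
    exact ⟨ht, hc, h3, h5, fun u => h6 u u.2⟩

theorem ends_readTable (h : Ctx D S i σ) :
    Ends readTable σ fun t σ' => t ≤ 6 * n + 2 ∧ Ctx D S i σ' ∧
      ∀ u : Fin n, σ'.arr 3 0 u = σ.arr 6 (σ.arr 3 0 u) (σ.arr 5 0 u) := by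
  refine (Ends.forLoop (n := n) (c := 4) (I := fun i' τ => Ctx D S i τ ∧ τ.arr 5 = σ.arr 5 ∧
    τ.arr 6 = σ.arr 6 ∧ ∀ u : Fin n, τ.arr 3 0 u =
      if (u : ℕ) < i' then σ.arr 6 (σ.arr 3 0 u) (σ.arr 5 0 u) else σ.arr 3 0 u)
    (by decide) ?_ h.reg_zero (by simpa using h)).mono ?_
  · rintro i' hi τ ⟨hc, h5, h6, h3⟩ hx hy
    obtain ⟨v, rfl⟩ : ∃ v : Fin n, i' = v := ⟨⟨i', hi⟩, rfl⟩
    have hv := h3 v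
    rw [if_neg (lt_irrefl _)] at hv
    simp only [ends_seq, ends_load, ends_store]
    refine ⟨by simpa using hx, by simpa using hy, by simp, by simpa using hc, by simpa using h5,
      by simpa using h6, fun u => ?_⟩
    by_cases huv : u = v
    · subst huv
      simp [hx, hc.reg_four, hv, h5, h6]
    · have hlt : (u : ℕ) < v + 1 ↔ (u : ℕ) < v := by
        have : (u : ℕ) ≠ v := fun h => huv (Fin.ext h)
        omega
      simp only [hlt]
      simpa [hx, hc.reg_four, Fin.val_inj, huv] using h3 u
  · rintro t τ ⟨ht, hc, -, -, h3⟩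
    exact ⟨ht, hc, fun u => by rw [h3, if_pos u.2]⟩

/-- Refine the coloring in row `0` of array `3` by the maximal SC clustering for the current set. -/
def round : RamProgram :=
  .seq findTop <| .seq walk <| .seq assign <| .seq colorAll <| .seq fillTable readTable

theorem ends_round {j : Fin k} (hj : G.IsSC (S j)) (h : Ctx D S j σ) :
    Ends round σ fun t σ' => t ≤ 67 * n + 16 ∧ Ctx D S j σ' ∧ ∀ u v : Fin n,
      σ'.arr 3 0 u = σ'.arr 3 0 v ↔ σ.arr 3 0 u = σ.arr 3 0 v ∧
        ∃ C, (C = S j ∨ G.IsMaxAway (S j) C) ∧ u ∈ C ∧ v ∈ C := by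
  simp only [round, ends_seq]
  refine (ends_findTop hj h).mono ?_
  rintro t₁ σ₁ ⟨ht₁, h₁, ho₁, h4₁, a, ha, h8₁⟩
  refine (ends_walk hj h₁ ha h8₁ h4₁).mono ?_
  rintro t₂ σ₂ ⟨ht₂, h₂, ho₂, h4₂⟩
  refine (ends_assign hj h₂ ha h4₂).mono ?_
  rintro t₃ σ₃ ⟨ht₃, h₃, ho₃, h5₃⟩
  refine (ends_colorAll hj h₃ ha h5₃).mono ?_
  rintro t₄ σ₄ ⟨ht₄, h₄, ho₄, h5₄⟩
  refine (ends_fillTable h₄).mono ?_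
  rintro t₅ σ₅ ⟨ht₅, h₅, ho₅, h5₅, h6₅⟩
  refine (ends_readTable h₅).mono ?_
  rintro t₆ σ₆ ⟨ht₆, h₆, h3₆⟩
  refine ⟨by omega, h₆, fun u v => ?_⟩
  rw [← (h5₄ u).eq_iff ha.1 (h5₄ v), h3₆, h3₆, h5₅, ho₅, ← ho₁, ← ho₂, ← ho₃, ← ho₄]
  constructor
  · intro he
    obtain ⟨w, hw, hw3, hw5⟩ := h6₅ u
    obtain ⟨w', hw', hw3', hw5'⟩ := h6₅ v
    rw [hw, hw'] at he
    obtain rfl := Fin.ext he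
    exact ⟨hw3.symm.trans hw3', hw5.symm.trans hw5'⟩
  · rintro ⟨h3, h5⟩
    rw [h3, h5]

/-- Compute the overlay clustering. -/
def overlay : RamProgram := .seq (.const 5 1) (forLoop 3 1 round)

theorem Ctx.setReg_three (h : Ctx D S i σ) (i' : ℕ) : Ctx D S i' (σ.setReg 3 i') where
  reg_zero := by simpa using h.reg_zero
  reg_one := by simpa using h.reg_one
  reg_two := by simpa using h.reg_two
  reg_three := by simp
  reg_four := by simpa using h.reg_four
  reg_five := by simpa using h.reg_five
  parent := h.parent
  opposite := h.opposite
  member := h.member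

theorem ctx_initialState (D : Preprocessed G) (S : Fin k → Finset (Fin n)) :
    Ctx D S 0 ((initialState D S).setReg 5 1) := by
  constructor <;> simp [initialState, membershipTable]

theorem ends_overlay (D : Preprocessed G) (hS : ∀ i, G.IsSC (S i)) :
    Ends overlay (initialState D S) fun t σ' => t ≤ (67 * n + 18) * k + 3 ∧ ∀ u v : Fin n,
      σ'.arr 3 0 u = σ'.arr 3 0 v ↔
        ∀ j, ∃ C, (C = S j ∨ G.IsMaxAway (S j) C) ∧ u ∈ C ∧ v ∈ C := by
  rw [overlay, ends_seq, ends_const]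
  have hinit := ctx_initialState D S
  refine (Ends.forLoop (n := k) (c := 67 * n + 16) (I := fun i τ => Ctx D S i τ ∧
    ∀ u v : Fin n, τ.arr 3 0 u = τ.arr 3 0 v ↔ ∀ j : Fin k, j < i →
      ∃ C, (C = S j ∨ G.IsMaxAway (S j) C) ∧ u ∈ C ∧ v ∈ C) (by decide) ?_ hinit.reg_one
    ⟨hinit.setReg_three 0, by simp [initialState]⟩).mono ?_
  · rintro i hi τ ⟨hc, h3⟩ hx hy
    obtain ⟨j, rfl⟩ : ∃ j : Fin k, i = j := ⟨⟨i, hi⟩, rfl⟩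
    refine (ends_round (hS j) hc).mono ?_
    rintro t τ' ⟨ht, hc', h3'⟩
    refine ⟨hc'.reg_three, hc'.reg_one, ht, hc'.setReg_three _, fun u v => ?_⟩
    rw [RamState.setReg_arr, h3', h3]
    constructor
    · rintro ⟨h1, h2⟩ j' hj'
      by_cases hjj : j' = j
      · rwa [hjj]
      · exact h1 j' (by omega)
    · exact fun H => ⟨fun j' hj' => H j' (by omega), H j (by omega)⟩
  · rintro t τ ⟨ht, hc, h3⟩
    refine ⟨(Nat.add_le_add_left ht 1).trans (le_of_eq (by ring)), fun u v => ?_⟩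
    rw [h3]
    exact forall_congr' fun j => ⟨fun H => H j.2, fun H _ => H⟩

end OverlayProgram

theorem theorem5 :
    (∀ (V : Type*) [Fintype V] [DecidableEq V] (G : WeightedGraph V) (k : ℕ)
      (S : Fin k → Finset V), (∀ i, G.IsSC (S i)) → Pairwise (fun i j => Disjoint (S i) (S j)) →
      -- the maximal SC clusterings `Ω(S i)` are well defined
      (∀ i, ∃! Ω : WeightedGraph.Clustering V, G.IsMaxSCClustering (S i) Ω) ∧
      -- the overlay clustering exists, is unique, and has the stated properties
      (∃! Ω : WeightedGraph.Clustering V, G.IsOverlayClustering S Ω) ∧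
      ∀ Ω : WeightedGraph.Clustering V, G.IsOverlayClustering S Ω →
        (∀ i, S i ∈ Ω.parts) ∧
        (∀ i, ∀ Ωi : WeightedGraph.Clustering V, G.IsMaxSCClustering (S i) Ωi → Ω ≤ Ωi) ∧
        (∀ Ω' : WeightedGraph.Clustering V, G.IsSCClustering Ω' → (∀ i, S i ∈ Ω'.parts) →
          Ω' ≤ Ω)) ∧
    -- one program computes it from the preprocessed data in time `O(k n)`
    (∃ (p : RamProgram) (c : ℕ), ∀ (n k : ℕ) (G : WeightedGraph (Fin n)) (D : Preprocessed G)
      (S : Fin k → Finset (Fin n)), 1 ≤ k → (∀ i, G.IsSC (S i)) →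
      Pairwise (fun i j => Disjoint (S i) (S j)) →
      ∀ Ω : WeightedGraph.Clustering (Fin n), G.IsOverlayClustering S Ω →
        ∃ (t : ℕ) (σ : RamState), RamProgram.Runs p (initialState D S) t σ ∧ t ≤ c * (k * n) ∧
          EncodesClustering σ Ω) := by
  refine ⟨fun V _ _ G k S hS hdisj => ⟨fun i => G.existsUnique_isMaxSCClustering (hS i),
    G.existsUnique_isOverlayClustering S, fun Ω hΩ => ⟨hΩ.mem_parts hS hdisj, hΩ.1,
      fun Ω' => hΩ.le_of_isSCClustering⟩⟩, OverlayProgram.overlay, 88, ?_⟩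
  intro n k G D S hk hS _ Ω hΩ
  obtain ⟨t, σ, hrun, ht, hσ⟩ := OverlayProgram.ends_overlay (S := S) D hS
  refine ⟨t, σ, hrun, ?_, fun u v => (hσ u v).trans (hΩ.sameCluster_iff hS u v).symm⟩
  -- The root witnesses n ≥ 1. Together with k ≥ 1 this absorbs 18 k + 3 into 21 k n, and 67 + 21 =
  -- 88.
  have hn : 1 ≤ n := by have := D.root.2; omega
  have h1 : k ≤ k * n := Nat.le_mul_of_pos_right k hn
  have h2 : (67 * n + 18) * k = 67 * (k * n) + 18 * k := by ring
  omega
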